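/- Let $\mathcal F=\bigoplus_{n\ge 0}L^2_{\rm sym}((\mathbb R^3)^n)$ be the bosonic Fock space in momentum representation. Put $\hat v(\xi)=\frac{1}{4\pi|\xi|}$ (which is not in $L^2(\mathbb R^3)$), fix $P\in\mathbb R^3$ and $\alpha>0$, and let $H_0=(P-P_f)^2+N+1$, i.e. multiplication by $(P-\sum_{j=1}^n k_j)^2+n+1$ on the $n$-particle component, with its maximal domain $D(H_0)$. Let $$(a(v)\Psi)^{(n)}(k_1,\dots,k_n)=\sqrt{n+1}\int_{\mathbb R^3}\hat v(\xi)\,\Psi^{(n+1)}(\xi,k_1,\dots,k_n)\,d\xi ,$$ $$(a^*(v)\Psi)^{(n)}(k_1,\dots,k_n)=\frac1{\sqrt n}\sum_{j=1}^n\hat v(k_j)\,\Psi^{(n-1)}(k_1,\dots,k_{j-1},k_{j+1},\dots,k_n),\qquad (a^*(v)\Psi)^{(0)}=0 .$$ The function $a^*(v)\Psi$ is in general not in $\mathcal F$; $H_0^{-1}a^*(v)\Psi$ denotes its quotient by the function defining $H_0$. Consider the quadratic form $$Q_P(\Psi)=\|H_0^{1/2}\Psi\|^2+2\sqrt\alpha\,\operatorname{Re}\langle\Psi,a(v)\Psi\rangle,\qquad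 \Psi\in D(H_0^{1/2}),$$ where $\langle\Psi,a(v)\Psi\rangle=\sum_n\langle\Psi^{(n)},(a(v)\Psi)^{(n)}\rangle$; this is the form of the formal expression $H(P)+1=(P-P_f)^2+N+\sqrt\alpha\,(a(v)+a^*(v))+1$. Then $Q_P$ is well defined on $D(H_0^{1/2})$ (for every $\Psi$ in this domain the integrals defining $a(v)\Psi$ converge absolutely almost everywhere, each $(a(v)\Psi)^{(n)}$ is in $L^2$, and the series converges absolutely), the operators $a(v)H_0^{-1}$ and $H_0^{-1}a^*(v)$ are defined on all of $\mathcal F$, and the operator $$H(P)+1:=K(P)+T(P),\quad K(P)=(1+\sqrt\alpha\,a(v)H_0^{-1})\,H_0\,(1+\sqrt\alpha\,H_0^{-1}a^*(v)),\quad T(P)=-\alpha\,a(v)H_0^{-1}a^*(v),$$ on its natural domain, has the domain $$D(H(P))=\{\Psi\in\mathcal F : (1+\sqrt\alpha\,H_0^{-1}a^*(v))\Psi\in D(H_0)\},$$ is self-adjoint, and $Q_P$ is its form: $Q_P$ is bounded below and closed on $D(H_0^{1/2})$, $D(H(P))\subset D(H_0^{1/2})$ is a form core for $Q_P$, and $Q_P(\Psi)=\langle\Psi,(H(P)+1)\Psi\rangle$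 for all $\Psi\in D(H(P))$. -/

import Mathlib

open MeasureTheory Filter Topology

noncomputable section

namespace Froehlich

/-! ### Bosonic Fock space over `L²(ℝ³)`, in momentum representation -/

/-- Momentum space `ℝ³`. -/
abbrev R3 : Type := EuclideanSpace ℝ (Fin 3)

/-- The `n`-particle space `L²((ℝ³)ⁿ)` (for `n = 0`: functions on a point, i.e. `ℂ`). -/
abbrev L2n (n : ℕ) : Type := Lp ℂ 2 (volume : Measure (Fin n → R3))

theorem measurePreserving_perm {n : ℕ} (σ : Equiv.Perm (Fin n)) :
    MeasurePreserving (fun k : Fin n → R3 => k ∘ σ) volume volume := by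
  have h := volume_measurePreserving_piCongrLeft (fun _ : Fin n => R3) σ.symm
  have he : (fun k : Fin n → R3 => k ∘ σ)
      = ⇑(MeasurableEquiv.piCongrLeft (fun _ : Fin n => R3) σ.symm) := by
    funext k i
    have := MeasurableEquiv.piCongrLeft_apply_apply (β := fun _ : Fin n => R3) σ.symm k (σ i)
    simpa using this.symm
  rw [he]
  exact h

/-- The action `f ↦ ((k₁, …, kₙ) ↦ f (k_{σ 1}, …, k_{σ n}))` of a permutation on `L²((ℝ³)ⁿ)`. -/
def permAct {n : ℕ} (σ : Equiv.Perm (Fin n)) : L2n n →ₗᵢ[ℂ] L2n n :=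
  Lp.compMeasurePreservingₗᵢ ℂ (fun k : Fin n → R3 => k ∘ σ) (measurePreserving_perm σ)

/-- The symmetric `n`-particle space `L²_sym((ℝ³)ⁿ)`. -/
def bosons (n : ℕ) : Submodule ℂ (L2n n) where
  carrier := {f | ∀ σ : Equiv.Perm (Fin n), permAct σ f = f}
  zero_mem' := fun σ => map_zero _
  add_mem' := fun {f g} hf hg σ => by rw [map_add, hf σ, hg σ]
  smul_mem' := fun c f hf σ => by rw [map_smul, hf σ]

theorem isClosed_bosons (n : ℕ) : IsClosed (bosons n : Set (L2n n)) := by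
  have : (bosons n : Set (L2n n)) = ⋂ σ : Equiv.Perm (Fin n), {f | permAct σ f = f} := by
    ext f
    simp [bosons]
  rw [this]
  exact isClosed_iInter fun σ => isClosed_eq (permAct σ).continuous continuous_id

instance completeSpace_bosons (n : ℕ) : CompleteSpace (bosons n) :=
  (isClosed_bosons n).completeSpace_coe

/-- The bosonic Fock space `⨁ₙ L²_sym((ℝ³)ⁿ)` (Hilbert sum). -/
abbrev Fock : Type := lp (fun n : ℕ => bosons n) 2

/-- The `n`-particle component `Ψ⁽ⁿ⁾` as a function of the `n` momenta (defined a.e.). -/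
def comp (Ψ : Fock) (n : ℕ) : (Fin n → R3) → ℂ := ⇑((Ψ n : bosons n) : L2n n)

theorem comp_add (Ψ Φ : Fock) (n : ℕ) : comp (Ψ + Φ) n =ᵐ[volume] comp Ψ n + comp Φ n :=
  Lp.coeFn_add ((Ψ n : bosons n) : L2n n) ((Φ n : bosons n) : L2n n)

theorem comp_smul (c : ℂ) (Ψ : Fock) (n : ℕ) : comp (c • Ψ) n =ᵐ[volume] c • comp Ψ n :=
  Lp.coeFn_smul c ((Ψ n : bosons n) : L2n n)

theorem comp_zero (n : ℕ) : comp (0 : Fock) n =ᵐ[volume] 0 :=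
  Lp.coeFn_zero ℂ 2 (volume : Measure (Fin n → R3))

theorem eq_zero_of_comp {Ψ : Fock} (h : ∀ n, comp Ψ n =ᵐ[volume] 0) : Ψ = 0 := by
  ext1
  funext n
  apply Subtype.ext
  apply Lp.ext
  exact (h n).trans (comp_zero n).symm

/-! ### Unbounded operators -/

/-- The composition `g ∘ f` of unbounded operators on its natural domain
`{x ∈ D(f) | f x ∈ D(g)}`. -/
def pcomp {E : Type*} [AddCommGroup E] [Module ℂ E] (g f : E →ₗ.[ℂ] E) : E →ₗ.[ℂ] E where
  domain := (g.domain.comap f.toFun).map f.domain.subtype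
  toFun :=
    { toFun := fun x => g ⟨f ⟨x, by obtain ⟨y, -, hy⟩ := x.2; rw [← hy]; exact y.2⟩, by
        obtain ⟨y, hy, hyx⟩ := x.2
        have : (⟨x, by rw [← hyx]; exact y.2⟩ : f.domain) = y := Subtype.ext hyx.symm
        rw [this]; exact hy⟩
      map_add' := fun x y => by
        rw [← LinearPMap.map_add]; congr 1; apply Subtype.ext
        exact LinearPMap.map_add f ⟨x, _⟩ ⟨y, _⟩
      map_smul' := fun c x => by
        rw [RingHom.id_apply, ← LinearPMap.map_smul]; congr 1; apply Subtype.ext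
        exact LinearPMap.map_smul f c ⟨x, _⟩ }

theorem mem_pcomp_domain {E : Type*} [AddCommGroup E] [Module ℂ E] (g f : E →ₗ.[ℂ] E) (x : E) :
    x ∈ (pcomp g f).domain ↔ ∃ hx : x ∈ f.domain, f ⟨x, hx⟩ ∈ g.domain := by
  constructor
  · rintro ⟨y, hy, rfl⟩
    exact ⟨y.2, hy⟩
  · rintro ⟨hx, h⟩
    exact ⟨⟨x, hx⟩, h, rfl⟩

/-- The identity as an everywhere defined operator. -/
def pone {E : Type*} [AddCommGroup E] [Module ℂ E] : E →ₗ.[ℂ] E := LinearMap.id.toPMap ⊤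

/-- A quadratic form `q` with form domain `D` is the form of the operator `A`: `A` is self-adjoint,
`q` is bounded below and extends `Ψ ↦ ⟪Ψ, A Ψ⟫` from `D(A)` to `D`, `q` is closed on `D`, and `D(A)`
is a form core. That is, `q` is the closure of the quadratic form of the semibounded self-adjoint
operator `A`. -/
structure IsFormOf {E : Type*} [NormedAddCommGroup E] [InnerProductSpace ℂ E] [CompleteSpace E]
    (D : Submodule ℂ E) (q : D → ℝ) (A : E →ₗ.[ℂ] E) : Prop where
  selfAdjoint : IsSelfAdjoint A
  bounded_below : ∃ m : ℝ, ∀ Ψ : D, m * ‖Ψ‖ ^ 2 ≤ q Ψ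
  domain_le : A.domain ≤ D
  eq_inner : ∀ Ψ : A.domain, (q ⟨Ψ, domain_le Ψ.2⟩ : ℂ) = inner ℂ (Ψ : E) (A Ψ)
  closed : ∀ (u : ℕ → D) (Ψ : E), Tendsto (fun j => (u j : E)) atTop (𝓝 Ψ) →
    Tendsto (fun p : ℕ × ℕ => q (u p.1 - u p.2)) atTop (𝓝 0) →
    ∃ hΨ : Ψ ∈ D, Tendsto (fun j => q (u j - ⟨Ψ, hΨ⟩)) atTop (𝓝 0)
  core : ∀ Ψ : D, ∃ u : ℕ → D, (∀ j, (u j : E) ∈ A.domain) ∧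
    Tendsto (fun j => (u j : E)) atTop (𝓝 (Ψ : E)) ∧
    Tendsto (fun j => q (u j - Ψ)) atTop (𝓝 0)

/-! ### Multiplication operators in the momenta -/

/-- The graph of multiplication by the functions `w n` of the momenta: all `(Ψ, Φ)` with
`Φ⁽ⁿ⁾ = w n · Ψ⁽ⁿ⁾` for all `n`. -/
def multGraph (w : ∀ n : ℕ, (Fin n → R3) → ℝ) : Submodule ℂ (Fock × Fock) where
  carrier := {p | ∀ n, ∀ᵐ k, comp p.2 n k = (w n k : ℂ) * comp p.1 n k}
  zero_mem' := fun n => by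
    filter_upwards [comp_zero n] with k hk
    simp [hk]
  add_mem' := fun {p q} hp hq n => by
    filter_upwards [hp n, hq n, comp_add p.1 q.1 n, comp_add p.2 q.2 n] with k h1 h2 h3 h4
    simp only [Prod.fst_add, Prod.snd_add, h3, h4, Pi.add_apply, h1, h2]
    ring
  smul_mem' := fun c p hp n => by
    filter_upwards [hp n, comp_smul c p.1 n, comp_smul c p.2 n] with k h1 h3 h4
    simp only [Prod.smul_fst, Prod.smul_snd, h3, h4, Pi.smul_apply, h1, smul_eq_mul]
    ring

theorem multGraph_singleValued (w : ∀ n : ℕ, (Fin n → R3) → ℝ) :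
    ∀ p ∈ multGraph w, p.1 = 0 → p.2 = 0 := by
  rintro ⟨Ψ, Φ⟩ hp rfl
  refine eq_zero_of_comp fun n => ?_
  filter_upwards [hp n, comp_zero n] with k h1 h2
  rw [h1, h2]
  simp

/-- The (maximal) operator of multiplication by the functions `w n` of the momenta. -/
def multOp (w : ∀ n : ℕ, (Fin n → R3) → ℝ) : Fock →ₗ.[ℂ] Fock := (multGraph w).toLinearPMap

/-- The function `(P - ∑ⱼ kⱼ)² + n + 1`. -/
def energy (P : R3) (n : ℕ) (k : Fin n → R3) : ℝ := ‖P - ∑ j, k j‖ ^ 2 + n + 1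

/-- `H₀ = (P - P_f)² + N + 1`. -/
def H0 (P : R3) : Fock →ₗ.[ℂ] Fock := multOp (energy P)

/-- `H₀^{1/2}`. -/
def H0sqrt (P : R3) : Fock →ₗ.[ℂ] Fock := multOp fun n k => √(energy P n k)

/-- `H₀⁻¹`. -/
def H0inv (P : R3) : Fock →ₗ.[ℂ] Fock := multOp fun n k => (energy P n k)⁻¹

/-! ### Annihilation and creation -/

/-- The form factor `v̂(ξ) = 1 / (4π|ξ|)` in momentum space, which is not in `L²`. -/
def vhat (ξ : R3) : ℝ := 1 / (4 * Real.pi * ‖ξ‖)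

/-- `(a(v)Ψ)⁽ⁿ⁾(k) = √(n+1) ∫ v̂(ξ) Ψ⁽ⁿ⁺¹⁾(ξ, k) dξ`. -/
def annih (Ψ : Fock) (n : ℕ) (k : Fin n → R3) : ℂ :=
  (√(n + 1) : ℝ) * ∫ ξ : R3, (vhat ξ : ℂ) * comp Ψ (n + 1) (Fin.cons ξ k)

/-- The integrals that define `a(v)Ψ` converge absolutely for almost all momenta. -/
def AnnihConv (Ψ : Fock) : Prop :=
  ∀ n : ℕ, ∀ᵐ k : Fin n → R3,
    Integrable fun ξ : R3 => (vhat ξ : ℂ) * comp Ψ (n + 1) (Fin.cons ξ k)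

/-- The measurable function (in general not in `L²`)
`(a*(v)Ψ)⁽ⁿ⁾(k₁, …, kₙ) = n^{-1/2} ∑ⱼ v̂(kⱼ) Ψ⁽ⁿ⁻¹⁾(k₁, …, kⱼ₋₁, kⱼ₊₁, …, kₙ)`. -/
def creat (Ψ : Fock) : ∀ n : ℕ, (Fin n → R3) → ℂ
  | 0, _ => 0
  | n + 1, k => ((√(n + 1))⁻¹ : ℝ) *
      ∑ j : Fin (n + 1), (vhat (k j) : ℂ) * comp Ψ n (fun i => k (j.succAbove i))

theorem ae_succAbove {n : ℕ} (j : Fin (n + 1)) {p : (Fin n → R3) → Prop} (h : ∀ᵐ k, p k) :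
    ∀ᵐ k : Fin (n + 1) → R3, p (fun i => k (j.succAbove i)) := by
  have h1 := volume_preserving_piFinSuccAbove (fun _ : Fin (n + 1) => R3) j
  have h2 : ∀ᵐ z : R3 × (Fin n → R3), p z.2 := Measure.quasiMeasurePreserving_snd.ae h
  exact h1.quasiMeasurePreserving.ae h2

theorem ae_cons {n : ℕ} {p : (Fin (n + 1) → R3) → Prop} (h : ∀ᵐ k, p k) :
    ∀ᵐ k : Fin n → R3, ∀ᵐ ξ : R3, p (Fin.cons ξ k) := by
  have h1 := (volume_preserving_piFinSuccAbove (fun _ : Fin (n + 1) => R3) 0).symm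
  have h2 := h1.quasiMeasurePreserving.ae h
  have h3 : ∀ᵐ z : (Fin n → R3) × R3, p (Fin.cons z.2 z.1) := by
    have := (Measure.measurePreserving_swap (μ := (volume : Measure (Fin n → R3)))
      (ν := (volume : Measure R3))).quasiMeasurePreserving.ae h2
    rw [← Measure.volume_eq_prod] at this
    simpa [MeasurableEquiv.piFinSuccAbove, Fin.insertNthEquiv] using this
  exact Measure.ae_ae_of_ae_prod h3

theorem creat_add (Ψ Φ : Fock) (n : ℕ) : creat (Ψ + Φ) n =ᵐ[volume] creat Ψ n + creat Φ n := by
  cases n with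
  | zero => exact Eventually.of_forall fun k => by simp [creat]
  | succ n =>
    have := ae_all_iff.2 fun j : Fin (n + 1) => ae_succAbove j (comp_add Ψ Φ n)
    filter_upwards [this] with k hk
    simp only [creat, Pi.add_apply, hk, mul_add, Finset.sum_add_distrib]

theorem creat_smul (c : ℂ) (Ψ : Fock) (n : ℕ) : creat (c • Ψ) n =ᵐ[volume] c • creat Ψ n := by
  cases n with
  | zero => exact Eventually.of_forall fun k => by simp [creat]
  | succ n =>
    have := ae_all_iff.2 fun j : Fin (n + 1) => ae_succAbove j (comp_smul c Ψ n)
    filter_upwards [this] with k hk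
    simp only [creat, Pi.smul_apply, hk, smul_eq_mul, Finset.mul_sum]
    exact Finset.sum_congr rfl fun j _ => by ring

theorem annihIntegrand_add (Ψ Φ : Fock) (n : ℕ) : ∀ᵐ k : Fin n → R3, ∀ᵐ ξ : R3,
    (vhat ξ : ℂ) * comp (Ψ + Φ) (n + 1) (Fin.cons ξ k)
      = (vhat ξ : ℂ) * comp Ψ (n + 1) (Fin.cons ξ k)
        + (vhat ξ : ℂ) * comp Φ (n + 1) (Fin.cons ξ k) := by
  filter_upwards [ae_cons (comp_add Ψ Φ (n + 1))] with k hk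
  filter_upwards [hk] with ξ h
  rw [h, Pi.add_apply, mul_add]

theorem annihIntegrand_smul (c : ℂ) (Ψ : Fock) (n : ℕ) : ∀ᵐ k : Fin n → R3, ∀ᵐ ξ : R3,
    (vhat ξ : ℂ) * comp (c • Ψ) (n + 1) (Fin.cons ξ k)
      = c * ((vhat ξ : ℂ) * comp Ψ (n + 1) (Fin.cons ξ k)) := by
  filter_upwards [ae_cons (comp_smul c Ψ (n + 1))] with k hk
  filter_upwards [hk] with ξ h
  rw [h, Pi.smul_apply, smul_eq_mul]
  ring

theorem annihIntegrand_zero (n : ℕ) : ∀ᵐ k : Fin n → R3, ∀ᵐ ξ : R3,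
    (vhat ξ : ℂ) * comp (0 : Fock) (n + 1) (Fin.cons ξ k) = 0 := by
  filter_upwards [ae_cons (comp_zero (n + 1))] with k hk
  filter_upwards [hk] with ξ h
  rw [h, Pi.zero_apply, mul_zero]

theorem annih_zero (n : ℕ) : annih 0 n =ᵐ[volume] 0 := by
  filter_upwards [annihIntegrand_zero n] with k hk
  simp only [annih, integral_congr_ae hk, integral_zero, mul_zero, Pi.zero_apply]

/-- The graph of `a(v)`: all `(Ψ, Φ)` for which the integrals defining `a(v)Ψ` converge absolutely
and `Φ⁽ⁿ⁾ = (a(v)Ψ)⁽ⁿ⁾` for all `n`. -/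
def annihGraph : Submodule ℂ (Fock × Fock) where
  carrier := {p | AnnihConv p.1 ∧ ∀ n, ∀ᵐ k, comp p.2 n k = annih p.1 n k}
  zero_mem' := by
    refine ⟨fun n => ?_, fun n => ?_⟩
    · filter_upwards [annihIntegrand_zero n] with k hk
      exact (integrable_zero R3 ℂ volume).congr (hk.mono fun ξ h => h.symm)
    · filter_upwards [comp_zero n, annih_zero n] with k h1 h2
      exact h1.trans h2.symm
  add_mem' := fun {p q} hp hq => by
    refine ⟨fun n => ?_, fun n => ?_⟩
    · filter_upwards [annihIntegrand_add p.1 q.1 n, hp.1 n, hq.1 n] with k hk h1 h2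
      exact (h1.add h2).congr (hk.mono fun ξ h => h.symm)
    · filter_upwards [annihIntegrand_add p.1 q.1 n, hp.1 n, hq.1 n, hp.2 n, hq.2 n,
        comp_add p.2 q.2 n] with k hk h1 h2 h3 h4 h5
      simp only [Prod.snd_add, Prod.fst_add, h5, Pi.add_apply, h3, h4, annih]
      rw [integral_congr_ae hk, integral_add h1 h2, mul_add]
  smul_mem' := fun c p hp => by
    refine ⟨fun n => ?_, fun n => ?_⟩
    · filter_upwards [annihIntegrand_smul c p.1 n, hp.1 n] with k hk h1
      exact (h1.const_mul c).congr (hk.mono fun ξ h => h.symm)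
    · filter_upwards [annihIntegrand_smul c p.1 n, hp.2 n, comp_smul c p.2 n] with k hk h3 h5
      simp only [Prod.smul_snd, Prod.smul_fst, h5, Pi.smul_apply, h3, annih, smul_eq_mul]
      rw [integral_congr_ae hk, integral_const_mul]
      ring

theorem annihGraph_singleValued : ∀ p ∈ annihGraph, p.1 = 0 → p.2 = 0 := by
  rintro ⟨Ψ, Φ⟩ hp rfl
  refine eq_zero_of_comp fun n => ?_
  filter_upwards [hp.2 n, annih_zero n] with k h1 h2
  exact h1.trans h2

/-- The annihilation operator `a(v)` on its natural domain. -/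
def annihOp : Fock →ₗ.[ℂ] Fock := annihGraph.toLinearPMap

/-- The graph of `H₀⁻¹a*(v)`: all `(Ψ, Φ)` with
`Φ⁽ⁿ⁾ = ((P - ∑ⱼ kⱼ)² + n + 1)⁻¹ (a*(v)Ψ)⁽ⁿ⁾` for all `n`. -/
def H0invCreatGraph (P : R3) : Submodule ℂ (Fock × Fock) where
  carrier := {p | ∀ n, ∀ᵐ k, comp p.2 n k = ((energy P n k)⁻¹ : ℝ) * creat p.1 n k}
  zero_mem' := fun n => by
    filter_upwards [comp_zero n, creat_smul 0 0 n] with k h1 h2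
    rw [zero_smul] at h2
    change comp (0 : Fock) n k = _ * creat (0 : Fock) n k
    rw [h1, h2]
    simp
  add_mem' := fun {p q} hp hq n => by
    filter_upwards [hp n, hq n, creat_add p.1 q.1 n, comp_add p.2 q.2 n] with k h1 h2 h3 h4
    simp only [Prod.fst_add, Prod.snd_add, h3, h4, Pi.add_apply, h1, h2]
    ring
  smul_mem' := fun c p hp n => by
    filter_upwards [hp n, creat_smul c p.1 n, comp_smul c p.2 n] with k h1 h3 h4
    simp only [Prod.smul_fst, Prod.smul_snd, h3, h4, Pi.smul_apply, h1, smul_eq_mul]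
    ring

theorem H0invCreatGraph_singleValued (P : R3) :
    ∀ p ∈ H0invCreatGraph P, p.1 = 0 → p.2 = 0 := by
  rintro ⟨Ψ, Φ⟩ hp rfl
  refine eq_zero_of_comp fun n => ?_
  filter_upwards [hp n, creat_smul 0 0 n] with k h1 h2
  rw [zero_smul] at h2
  rw [h1, h2]
  simp

/-- The operator `H₀⁻¹a*(v)` on its natural domain. -/
def H0invCreat (P : R3) : Fock →ₗ.[ℂ] Fock := (H0invCreatGraph P).toLinearPMap

/-! ### The Fröhlich Hamiltonian at fixed total momentum -/

/-- `1 + √α a(v)H₀⁻¹`. -/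
def leftFactor (α : ℝ) (P : R3) : Fock →ₗ.[ℂ] Fock :=
  pone + ((√α : ℝ) : ℂ) • pcomp annihOp (H0inv P)

/-- `1 + √α H₀⁻¹a*(v)`. -/
def rightFactor (α : ℝ) (P : R3) : Fock →ₗ.[ℂ] Fock :=
  pone + ((√α : ℝ) : ℂ) • H0invCreat P

/-- `K(P) = (1 + √α a(v)H₀⁻¹) H₀ (1 + √α H₀⁻¹a*(v))` on its natural domain. -/
def K (α : ℝ) (P : R3) : Fock →ₗ.[ℂ] Fock :=
  pcomp (leftFactor α P) (pcomp (H0 P) (rightFactor α P))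

/-- `T(P) = -α a(v)H₀⁻¹a*(v)` on its natural domain. -/
def T (α : ℝ) (P : R3) : Fock →ₗ.[ℂ] Fock :=
  -((α : ℂ) • pcomp annihOp (H0invCreat P))

/-- The form domain `D(H₀^{1/2})`. -/
def formDomain (P : R3) : Submodule ℂ Fock := (H0sqrt P).domain

/-- The term `⟪Ψ⁽ⁿ⁾, (a(v)Ψ)⁽ⁿ⁾⟫` of `⟪Ψ, a(v)Ψ⟫`. -/
def interactionTerm (Ψ : Fock) (n : ℕ) : ℂ :=
  ∫ k : Fin n → R3, (starRingEnd ℂ) (comp Ψ n k) * annih Ψ n k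

/-- The quadratic form `Q_P(Ψ) = ‖H₀^{1/2}Ψ‖² + 2√α Re ⟪Ψ, a(v)Ψ⟫` on `D(H₀^{1/2})`. -/
def Q (α : ℝ) (P : R3) (Ψ : formDomain P) : ℝ :=
  ‖H0sqrt P Ψ‖ ^ 2 + 2 * √α * (∑' n, interactionTerm (Ψ : Fock) n).re

end Froehlich

end

/-! Put `S` = H₀^{-1/2}, `G` = H₀^{-1/2} a(v) H₀^{-1/2} and `L` = 1 + √α (G + G*). For Ψ = S g the
form is Q_P(Ψ) = ⟪g, L g⟫, and formally H(P) + 1 = S⁻¹ L S⁻¹. If S and L are bounded and symmetric,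
S is injective and L + λS² is coercive, then M = L + λS² is invertible, S M⁻¹ S inverts H(P) + 1 +
λ, and self-adjointness, closedness and the form core all follow (`isFormOf_of_graph`).

The analytic input is ∫ v̂(ξ)² / (|p - ξ|² + m) dξ ≤ const · m^{-1/2}, uniformly in p
(`lintegral_vhat_sq_le`). By Cauchy–Schwarz, a(v)H₀^{-1/2} from n + 1 to n particles has norm at
most const · rₙ with rₙ = (n + 1)^{1/4}, while H₀^{-1/2} is at most rₙ⁻² on n particles. Counting
powers of r (`LadderBounds`) shows that G is bounded and that the interaction is form small up to a
multiple of ‖S g‖² (`L_coercive`).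

It remains to see that K + T, with its natural domain, has the graph of S⁻¹ L S⁻¹. If Ψ + √α
H₀⁻¹a*(v)Ψ = H₀⁻¹X, then Ψ is in the range of S (`exists_S_eq`); hence T is defined at Ψ and removes
from K exactly the surplus over X + √α a(v)Ψ (`K_add_T_component`). Conversely, a solution of L g =
S η has a(v) S g in Fock space (`memℓp_a_of_L_eq`). The two descriptions meet in `mem_K_add_T_graph`
and `L_eq_S_iff`. -/

noncomputable section

namespace Froehlich

/-! ### Self-adjoint operators from quadratic forms -/

section Abstract

variable {E : Type*} [NormedAddCommGroup E] [InnerProductSpace ℂ E] [CompleteSpace E]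

/-- A symmetric operator `A` for which `A + lam` is onto for some real `lam` is self-adjoint. -/
theorem isSelfAdjoint_of_surjective (A : E →ₗ.[ℂ] E) (lam : ℝ) (hA : A.IsFormalAdjoint A)
    (hs : ∀ η : E, ∃ x : A.domain, A x + (lam : ℂ) • (x : E) = η) : IsSelfAdjoint A := by
  have shift : ∀ x y : A.domain, inner ℂ (A x + (lam : ℂ) • (x : E)) (y : E)
      = inner ℂ (x : E) (A y + (lam : ℂ) • (y : E)) := by
    intro x y
    rw [inner_add_left, inner_add_right, hA x y, inner_smul_left, inner_smul_right,
      Complex.conj_ofReal]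
  -- For x orthogonal to the domain write x = (A + lam) y and y = (A + lam) z; then 0 = ⟪x, z⟫ = ⟪y,
  -- y⟫.
  have hd : Dense (A.domain : Set E) := by
    rw [Submodule.dense_iff_topologicalClosure_eq_top, Submodule.topologicalClosure_eq_top_iff,
      Submodule.eq_bot_iff]
    intro x hx
    obtain ⟨y, rfl⟩ := hs x
    obtain ⟨z, hz⟩ := hs y
    have h1 := Submodule.inner_left_of_mem_orthogonal z.2 hx
    rw [shift, hz, inner_self_eq_zero] at h1
    have : y = 0 := Subtype.ext h1
    simp [this]
  rw [LinearPMap.isSelfAdjoint_def]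
  have hle : A.adjoint ≤ A := by
    refine ⟨fun y hy => ?_, fun x y hxy => ?_⟩
    -- Choose w in the domain with (A + lam) w = (A* + lam) y. Then y - w is orthogonal to the range
    -- of A + lam, which is everything, so y = w.
    · obtain ⟨w, hw⟩ := hs (A.adjoint ⟨y, hy⟩ + (lam : ℂ) • y)
      have key : ∀ z : A.domain, inner ℂ (y - w) (A z + (lam : ℂ) • (z : E)) = 0 := by
        intro z
        rw [inner_sub_left, ← shift, hw, inner_add_left, inner_add_right, inner_smul_left,
          inner_smul_right, Complex.conj_ofReal, A.adjoint_isFormalAdjoint hd ⟨y, hy⟩ z, sub_self]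
      obtain ⟨z, hz⟩ := hs (y - w)
      have h1 := key z
      rw [hz, inner_self_eq_zero, sub_eq_zero] at h1
      rw [h1]
      exact w.2
    · refine LinearPMap.adjoint_apply_eq hd x fun z => ?_
      rw [hA y z, hxy]
  exact le_antisymm hle (hA.le_adjoint hd)

/-- Let `S` be bounded, symmetric and injective, and `L` bounded and symmetric such that
`L + lam S²` is coercive. If the graph of `A` is `{(S g, η) | L g = S η}`, i.e. formally
`A = S⁻¹ L S⁻¹`, then `S g ↦ ⟪g, L g⟫` is the form of `A`. -/
theorem isFormOf_of_graph (S L : E →L[ℂ] E) (hS : ∀ x y, inner ℂ (S x) y = inner ℂ x (S y))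
    (hSinj : Function.Injective S) (hL : ∀ x y, inner ℂ (L x) y = inner ℂ x (L y))
    (lam c : ℝ) (hc : 0 < c)
    (hcoer : ∀ g, c * ‖g‖ ^ 2 ≤ (inner ℂ g (L g)).re + lam * ‖S g‖ ^ 2)
    (D : Submodule ℂ E) (hD : ∀ Ψ, Ψ ∈ D ↔ ∃ g, S g = Ψ) (q : D → ℝ)
    (hq : ∀ (Ψ : D) (g : E), S g = Ψ → q Ψ = (inner ℂ g (L g)).re)
    (A : E →ₗ.[ℂ] E) (hA : ∀ Ψ η, (Ψ, η) ∈ A.graph ↔ ∃ g, S g = Ψ ∧ L g = S η) :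
    IsFormOf D q A := by
  -- Formally A + lam = S⁻¹ M S⁻¹; coercivity makes M invertible by Lax–Milgram.
  set M : E →L[ℂ] E := L + (lam : ℂ) • S.comp S with hM
  have Mapp : ∀ g, M g = L g + (lam : ℂ) • S (S g) := fun g => by simp [hM]
  have Mre : ∀ g, (inner ℂ (M g) g).re = (inner ℂ g (L g)).re + lam * ‖S g‖ ^ 2 := by
    intro g
    rw [Mapp, inner_add_left, inner_smul_left, Complex.conj_ofReal, hL, hS, Complex.add_re,
      Complex.re_ofReal_mul, inner_self_eq_norm_sq_to_K]
    norm_cast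
  have hMunit : IsUnit M := by
    refine ContinuousLinearMap.isUnit_of_forall_le_norm_inner_map M (c := ⟨c, hc.le⟩) hc fun x => ?_
    calc ‖x‖ ^ 2 * c ≤ (inner ℂ (M x) x).re := by rw [Mre, mul_comm]; exact hcoer x
      _ ≤ ‖inner ℂ (M x) x‖ := Complex.re_le_norm _
  obtain ⟨u, hu⟩ := hMunit
  have hMr : ∀ y, M ((↑u⁻¹ : E →L[ℂ] E) y) = y := fun y => by
    rw [← hu, ← mul_apply_eq_comp, u.mul_inv, one_apply_eq_self]
  have hMl : ∀ y, (↑u⁻¹ : E →L[ℂ] E) (M y) = y := fun y => by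
    rw [← hu, ← mul_apply_eq_comp, u.inv_mul, one_apply_eq_self]
  have hAx : ∀ x : A.domain, ∃ g, S g = x ∧ L g = S (A x) := fun x =>
    (hA x (A x)).1 (A.mem_graph x)
  -- The resolvent is S M⁻¹ S: with M g = S η one has L g = S (η - lam S g), which is the graph
  -- condition.
  have hsol : ∀ η, ∃ hx : S ((↑u⁻¹ : E →L[ℂ] E) (S η)) ∈ A.domain,
      A ⟨_, hx⟩ + (lam : ℂ) • S ((↑u⁻¹ : E →L[ℂ] E) (S η)) = η := by
    intro η
    set g := (↑u⁻¹ : E →L[ℂ] E) (S η) with hg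
    have hmem : (S g, η - (lam : ℂ) • S g) ∈ A.graph := by
      refine (hA _ _).2 ⟨g, rfl, ?_⟩
      have := hMr (S η)
      rw [← hg, Mapp] at this
      rw [map_sub, map_smul, ← this, add_sub_cancel_right]
    obtain ⟨x, hx1, hx2⟩ := (LinearPMap.mem_graph_iff _).1 hmem
    simp only at hx1 hx2
    refine ⟨hx1 ▸ x.2, ?_⟩
    have : (⟨S g, hx1 ▸ x.2⟩ : A.domain) = x := Subtype.ext hx1.symm
    rw [this, hx2, sub_add_cancel]
  have hsymm : A.IsFormalAdjoint A := by
    intro x y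
    obtain ⟨g, hg1, hg2⟩ := hAx x
    obtain ⟨f, hf1, hf2⟩ := hAx y
    rw [← hg1, ← hf1, ← hS, ← hg2, hS, ← hf2, hL]
  have hdom : A.domain ≤ D := fun x hx => by
    obtain ⟨g, hg, -⟩ := hAx ⟨x, hx⟩
    exact (hD x).2 ⟨g, hg⟩
  -- The orthogonal complement of the range of a symmetric operator is its kernel, here zero.
  have hSdense : Dense (Set.range S) := by
    have : Dense (S.range : Set E) := by
      rw [Submodule.dense_iff_topologicalClosure_eq_top, Submodule.topologicalClosure_eq_top_iff,
        Submodule.eq_bot_iff]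
      intro x hx
      refine hSinj ?_
      rw [map_zero, ← inner_self_eq_zero (𝕜 := ℂ), hS]
      exact Submodule.inner_left_of_mem_orthogonal (LinearMap.mem_range_self _ _) hx
    exact this
  have hqS : ∀ (Ψ : D) (g : E), S g = Ψ →
      c * ‖g‖ ^ 2 ≤ q Ψ + lam * ‖(Ψ : E)‖ ^ 2 := by
    intro Ψ g h
    rw [hq Ψ g h, ← h]
    exact hcoer g
  choose G hG using fun Ψ : D => (hD Ψ).1 Ψ.2
  have hcont : Continuous fun g => (inner ℂ g (L g)).re := by fun_prop
  have hcont0 : Tendsto (fun g => (inner ℂ g (L g)).re) (𝓝 0) (𝓝 0) := by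
    simpa using hcont.tendsto 0
  refine ⟨isSelfAdjoint_of_surjective A lam hsymm fun η => ?_, ⟨-lam, fun Ψ => ?_⟩, hdom,
    fun Ψ => ?_, fun v Ψ hv hqv => ?_, fun Ψ => ?_⟩
  · obtain ⟨hx, h⟩ := hsol η
    exact ⟨⟨_, hx⟩, h⟩
  · have := hqS Ψ (G Ψ) (hG Ψ)
    have : 0 ≤ c * ‖G Ψ‖ ^ 2 := by positivity
    change -lam * ‖(Ψ : E)‖ ^ 2 ≤ q Ψ
    linarith
  · obtain ⟨g, hg1, hg2⟩ := hAx Ψ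
    rw [hq ⟨Ψ, hdom Ψ.2⟩ g hg1, ← hg1, hS, ← hg2]
    refine Complex.conj_eq_iff_re.1 ?_
    rw [inner_conj_symm, hL]
  · have hGsub : ∀ i j, S (G (v i) - G (v j)) = ((v i - v j : D) : E) := fun i j => by
      rw [map_sub, hG, hG]; rfl
    have hdiff : Tendsto (fun p : ℕ × ℕ => ((v p.1 - v p.2 : D) : E)) atTop (𝓝 0) := by
      have h1 : Tendsto (fun p : ℕ × ℕ => ((v p.1 : E) - (v p.2 : E))) atTop (𝓝 (Ψ - Ψ)) :=
        by
        rw [← prod_atTop_atTop_eq]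
        exact (hv.comp tendsto_fst).sub (hv.comp tendsto_snd)
      simpa using h1
    have hsq : Tendsto (fun p : ℕ × ℕ => c⁻¹ * (q (v p.1 - v p.2)
        + lam * ‖((v p.1 - v p.2 : D) : E)‖ ^ 2)) atTop (𝓝 0) := by
      simpa using (hqv.add ((hdiff.norm.pow 2).const_mul lam)).const_mul c⁻¹
    -- Coercivity controls the preimages under S: a sequence that converges in E and is Cauchy for q
    -- has Cauchy preimages, and their limit is the preimage of Ψ.
    have hGsq : Tendsto (fun p : ℕ × ℕ => ‖G (v p.1) - G (v p.2)‖ ^ 2) atTop (𝓝 0) := by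
      refine squeeze_zero (fun p => by positivity) (fun p => ?_) hsq
      rw [inv_mul_eq_div, le_div_iff₀ hc, mul_comm]
      exact hqS _ _ (hGsub p.1 p.2)
    have hGn : Tendsto (fun p : ℕ × ℕ => dist (G (v p.1)) (G (v p.2))) atTop (𝓝 0) := by
      have := hGsq.sqrt
      simpa [Real.sqrt_sq, dist_eq_norm] using this
    have hC : CauchySeq fun j => G (v j) := by
      rw [cauchySeq_iff_tendsto_dist_atTop_0]
      exact hGn
    obtain ⟨g, hg⟩ := cauchySeq_tendsto_of_complete hC
    have hSg : S g = Ψ := by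
      refine tendsto_nhds_unique ((S.continuous.tendsto g).comp hg) ?_
      refine hv.congr fun j => (hG (v j)).symm
    have hΨ : Ψ ∈ D := (hD Ψ).2 ⟨g, hSg⟩
    refine ⟨hΨ, ?_⟩
    have h1 : ∀ j, q (v j - ⟨Ψ, hΨ⟩)
        = (inner ℂ (G (v j) - g) (L (G (v j) - g))).re := fun j => by
      refine hq _ _ ?_
      rw [map_sub, hG, hSg]; rfl
    simp_rw [h1]
    have h2 : Tendsto (fun j => G (v j) - g) atTop (𝓝 0) := by
      simpa using hg.sub_const g
    exact hcont0.comp h2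
  -- The domain of A contains all S M⁻¹ S η. Approximating M (G Ψ) by vectors S η makes M⁻¹ S η
  -- converge to G Ψ, which is convergence in the form norm.
  · have hx := hSdense (M (G Ψ))
    rw [mem_closure_iff_seq_limit] at hx
    obtain ⟨x, hx, hlim⟩ := hx
    choose η hη using hx
    have hlim2 : Tendsto (fun j => (↑u⁻¹ : E →L[ℂ] E) (S (η j))) atTop (𝓝 (G Ψ)) := by
      have := ((↑u⁻¹ : E →L[ℂ] E).continuous.tendsto _).comp hlim
      rw [hMl] at this
      exact this.congr fun j => by rw [Function.comp, ← hη]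
    have hm : ∀ j, S ((↑u⁻¹ : E →L[ℂ] E) (S (η j))) ∈ A.domain := fun j => (hsol (η j)).1
    refine ⟨fun j => ⟨_, hdom (hm j)⟩, hm, ?_, ?_⟩
    · have := (S.continuous.tendsto _).comp hlim2
      rwa [hG] at this
    · have h1 : ∀ j, q (⟨_, hdom (hm j)⟩ - Ψ)
          = (inner ℂ ((↑u⁻¹ : E →L[ℂ] E) (S (η j)) - G Ψ)
            (L ((↑u⁻¹ : E →L[ℂ] E) (S (η j)) - G Ψ))).re := fun j => by
        refine hq _ _ ?_
        rw [map_sub, hG]; rfl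
      simp_rw [h1]
      have h2 : Tendsto (fun j => (↑u⁻¹ : E →L[ℂ] E) (S (η j)) - G Ψ) atTop (𝓝 0) := by
        simpa using hlim2.sub_const (G Ψ)
      exact hcont0.comp h2

end Abstract

/-! ### Ladder operators on Hilbert sums -/

section Ladder

set_option linter.unusedSectionVars false

theorem memℓp_two_iff {h : ℕ → Type*} [∀ n, NormedAddCommGroup (h n)] {f : ∀ n, h n} :
    Memℓp f 2 ↔ Summable fun n => ‖f n‖ ^ 2 := by
  rw [memℓp_gen_iff (by norm_num)]
  simp

theorem memℓp_two_of_le {h : ℕ → Type*} [∀ n, NormedAddCommGroup (h n)] {f : ∀ n, h n}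
    {u : ℕ → ℝ} (hu : Memℓp u 2) (hf : ∀ n, ‖f n‖ ≤ u n) : Memℓp f 2 := by
  rw [memℓp_two_iff] at hu ⊢
  refine Summable.of_nonneg_of_le (fun n => by positivity) (fun n => ?_) hu
  rw [Real.norm_eq_abs, sq_abs]
  exact pow_le_pow_left₀ (norm_nonneg _) (hf n) 2

theorem memℓp_two_succ_iff {h : ℕ → Type*} [∀ n, NormedAddCommGroup (h n)] {f : ∀ n, h n} :
    Memℓp (fun n => f (n + 1)) 2 ↔ Memℓp f 2 := by
  rw [memℓp_two_iff, memℓp_two_iff]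
  exact summable_nat_add_iff (f := fun n => ‖f n‖ ^ 2) 1

theorem memℓp_two_norm {h : ℕ → Type*} [∀ n, NormedAddCommGroup (h n)] {f : ∀ n, h n}
    (hf : Memℓp f 2) : Memℓp (fun n => ‖f n‖) 2 := by
  rw [memℓp_two_iff] at hf ⊢
  simpa using hf

variable {h : ℕ → Type*} [∀ n, NormedAddCommGroup (h n)] [∀ n, InnerProductSpace ℂ (h n)]

theorem hasSum_norm_sq (f : lp h 2) : HasSum (fun n => ‖f n‖ ^ 2) (‖f‖ ^ 2) := by
  have := lp.hasSum_norm (p := 2) (by norm_num) f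
  simpa using this

theorem norm_sq_eq_tsum (f : lp h 2) : ‖f‖ ^ 2 = ∑' n, ‖f n‖ ^ 2 := (hasSum_norm_sq f).tsum_eq.symm

/-- The bounded operator `(g n) ↦ (t n (g (τ n)))` on a Hilbert sum. -/
def lpOp (τ : ℕ → ℕ) (hτ : Function.Injective τ) (t : ∀ n, h (τ n) →L[ℂ] h n) (C : ℝ)
    (ht : ∀ n x, ‖t n x‖ ≤ C * ‖x‖) : lp h 2 →L[ℂ] lp h 2 :=
  have hsum : ∀ g : lp h 2, Summable fun n => ‖g (τ n)‖ ^ 2 := fun g =>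
    (hasSum_norm_sq g).summable.comp_injective hτ
  have hle : ∀ (g : lp h 2) n, ‖t n (g (τ n))‖ ^ 2 ≤ C ^ 2 * ‖g (τ n)‖ ^ 2 := fun g n => by
    rw [← mul_pow]
    exact pow_le_pow_left₀ (norm_nonneg _) (ht n _) 2
  have hmem : ∀ g : lp h 2, Memℓp (fun n => t n (g (τ n))) 2 := fun g =>
    memℓp_two_iff.2 (Summable.of_nonneg_of_le (fun n => by positivity) (hle g)
      ((hsum g).mul_left _))
  LinearMap.mkContinuous
    { toFun := fun g => ⟨fun n => t n (g (τ n)), hmem g⟩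
      map_add' := fun f g => by
        ext n
        exact map_add (t n) _ _
      map_smul' := fun c f => by
        ext n
        exact map_smul (t n) _ _ } |C| (fun g => by
      refine (sq_le_sq₀ (norm_nonneg _) (mul_nonneg (abs_nonneg _) (norm_nonneg _))).1 ?_
      rw [mul_pow, sq_abs, norm_sq_eq_tsum, norm_sq_eq_tsum]
      calc ∑' n, ‖t n (g (τ n))‖ ^ 2 ≤ ∑' n, C ^ 2 * ‖g (τ n)‖ ^ 2 :=
            (memℓp_two_iff.1 (hmem g)).tsum_le_tsum (hle g) ((hsum g).mul_left _)
        _ = C ^ 2 * ∑' n, ‖g (τ n)‖ ^ 2 := tsum_mul_left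
        _ ≤ C ^ 2 * ∑' n, ‖g n‖ ^ 2 := by
            refine mul_le_mul_of_nonneg_left ?_ (by positivity)
            exact tsum_comp_le_tsum_of_inj (hasSum_norm_sq g).summable
              (fun n => by positivity) hτ)

variable [∀ n, CompleteSpace (h n)]

/-- The data of a number preserving operator `H₀^{-1/2} = ⨁ₙ sₙ` and of the operator
`aₙ : hₙ₊₁ → hₙ` (standing for `a(v) H₀^{-1/2}`) with weighted bounds; in the application
`rₙ = (n + 1)^{1/4}`. -/
structure LadderBounds (s : ∀ n, h n →L[ℂ] h n) (a : ∀ n, h (n + 1) →L[ℂ] h n)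
    (r : ℕ → ℝ) (C : ℝ) : Prop where
  one_le : ∀ n, 1 ≤ r n
  mono : ∀ n, r n ≤ r (n + 1)
  nonneg : 0 ≤ C
  symm : ∀ n x y, inner ℂ (s n x) y = inner ℂ x (s n y)
  inj : ∀ n x, s n x = 0 → x = 0
  s_le : ∀ n x, r n ^ 2 * ‖s n x‖ ≤ ‖x‖
  a_le : ∀ n x, ‖a n x‖ ≤ C * r n * ‖x‖

/-- `(Ψₙ) ↦ (aₙ₋₁† Ψₙ₋₁)`, standing for `H₀^{-1/2} a*(v)`. -/
def raise (a : ∀ n, h (n + 1) →L[ℂ] h n) (Ψ : ∀ n, h n) : ∀ n, h n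
  | 0 => 0
  | n + 1 => (a n).adjoint (Ψ n)

namespace LadderBounds

variable {s : ∀ n, h n →L[ℂ] h n} {a : ∀ n, h (n + 1) →L[ℂ] h n} {r : ℕ → ℝ} {C : ℝ}
  (B : LadderBounds s a r C)

include B

/-! ### Counting powers of r: each s gains r⁻², each a or a† loses r -/

theorem pos (n : ℕ) : 0 < r n := zero_lt_one.trans_le (B.one_le n)

theorem s_le' (n : ℕ) (x : h n) : ‖s n x‖ ≤ 1 * ‖x‖ := by
  have h1 := B.s_le n x
  have h2 := B.one_le n
  have h3 : 1 ≤ r n ^ 2 := one_le_pow₀ h2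
  nlinarith [norm_nonneg (s n x)]

theorem r_s_le (n : ℕ) (x : h n) : r n * ‖s n x‖ ≤ (r n)⁻¹ * ‖x‖ := by
  rw [inv_mul_eq_div, le_div_iff₀ (B.pos n)]
  have := B.s_le n x
  linarith

theorem adj_le (n : ℕ) (x : h n) : ‖(a n).adjoint x‖ ≤ C * r n * ‖x‖ := by
  have h1 : ‖a n‖ ≤ C * r n :=
    (a n).opNorm_le_bound (mul_nonneg B.nonneg (B.pos n).le) (B.a_le n)
  calc ‖(a n).adjoint x‖ ≤ ‖(a n).adjoint‖ * ‖x‖ := ContinuousLinearMap.le_opNorm _ _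
    _ = ‖a n‖ * ‖x‖ := by rw [LinearIsometryEquiv.norm_map]
    _ ≤ _ := by gcongr

theorem r_inv_le_one (n : ℕ) : (r n)⁻¹ ≤ 1 := inv_le_one_of_one_le₀ (B.one_le n)

theorem s_r_succ_le (n : ℕ) (x : h (n + 1)) : r n * ‖s (n + 1) x‖ ≤ (r (n + 1))⁻¹ * ‖x‖ :=
  (mul_le_mul_of_nonneg_right (B.mono n) (norm_nonneg _)).trans (B.r_s_le (n + 1) x)

theorem a_s_le (n : ℕ) (x : h (n + 1)) : ‖a n (s (n + 1) x)‖ ≤ C * ((r (n + 1))⁻¹ * ‖x‖) := by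
  refine (B.a_le n _).trans ?_
  rw [mul_assoc]
  exact mul_le_mul_of_nonneg_left (B.s_r_succ_le n x) B.nonneg

theorem a_s_le' (n : ℕ) (x : h (n + 1)) : ‖a n (s (n + 1) x)‖ ≤ C * ‖x‖ := by
  refine (B.a_s_le n x).trans (mul_le_mul_of_nonneg_left ?_ B.nonneg)
  exact mul_le_of_le_one_left (norm_nonneg _) (B.r_inv_le_one _)

/-- The two losses rₙ of a and a† use up the whole gain rₙ⁻² of s. This is what makes T available on
the range of `S`. -/
theorem a_adj_s_le (n : ℕ) (x : h n) : ‖a n ((a n).adjoint (s n x))‖ ≤ C ^ 2 * ‖x‖ := by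
  have h0 : 0 ≤ C * r n := mul_nonneg B.nonneg (B.pos n).le
  calc ‖a n ((a n).adjoint (s n x))‖ ≤ C * r n * (C * r n * ‖s n x‖) :=
        (B.a_le n _).trans (mul_le_mul_of_nonneg_left (B.adj_le n _) h0)
    _ = C ^ 2 * (r n ^ 2 * ‖s n x‖) := by ring
    _ ≤ _ := mul_le_mul_of_nonneg_left (B.s_le n x) (by positivity)

theorem s_a_le (n : ℕ) (x : h (n + 1)) : ‖s n (a n x)‖ ≤ C * ‖x‖ := by
  have h1 := B.r_s_le n (a n x)
  have h2 := B.a_le n x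
  have hr := B.pos n
  have h3 : ‖s n (a n x)‖ ≤ r n * ‖s n (a n x)‖ :=
    le_mul_of_one_le_left (norm_nonneg _) (B.one_le n)
  refine h3.trans (h1.trans ?_)
  rw [inv_mul_eq_div, div_le_iff₀ hr]
  linarith

/-- The product a s retains a gain r⁻¹ at level n + 1, which pays for the second a. -/
theorem a_s_a_le (n : ℕ) (x : h (n + 2)) : ‖a n (s (n + 1) (a (n + 1) x))‖ ≤ C ^ 2 * ‖x‖ := by
  refine (B.a_s_le n _).trans ?_
  have h2 := B.a_le (n + 1) x
  have hr := B.pos (n + 1)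
  rw [pow_two, mul_assoc]
  refine mul_le_mul_of_nonneg_left ?_ B.nonneg
  rw [inv_mul_eq_div, div_le_iff₀ hr]
  linarith

theorem s_adj_le (n : ℕ) (x : h n) : ‖s (n + 1) ((a n).adjoint x)‖ ≤ C * ‖x‖ := by
  have h1 := B.r_s_le (n + 1) ((a n).adjoint x)
  have h2 := B.adj_le n x
  have hr := B.pos (n + 1)
  have h3 : ‖s (n + 1) ((a n).adjoint x)‖ ≤ r (n + 1) * ‖s (n + 1) ((a n).adjoint x)‖ :=
    le_mul_of_one_le_left (norm_nonneg _) (B.one_le _)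
  refine h3.trans (h1.trans ?_)
  rw [inv_mul_eq_div, div_le_iff₀ hr]
  refine h2.trans ?_
  have := mul_le_mul_of_nonneg_right (B.mono n) (mul_nonneg B.nonneg (norm_nonneg x))
  linarith

theorem memℓp_s_raise (Ψ : lp h 2) : Memℓp (fun n => s n (raise a (Ψ : ∀ n, h n) n)) 2 := by
  rw [← memℓp_two_succ_iff]
  exact memℓp_two_of_le ((memℓp_two_norm (lp.memℓp Ψ)).const_mul C) fun n => B.s_adj_le n _

theorem memℓp_a_s (X : lp h 2) : Memℓp (fun n => a n (s (n + 1) (X (n + 1)))) 2 :=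
  memℓp_two_of_le ((memℓp_two_succ_iff.2 (memℓp_two_norm (lp.memℓp X))).const_mul C)
    fun n => B.a_s_le' n _

theorem memℓp_a_adj_s (g : lp h 2) : Memℓp (fun n => a n ((a n).adjoint (s n (g n)))) 2 :=
  memℓp_two_of_le ((memℓp_two_norm (lp.memℓp g)).const_mul (C ^ 2)) fun n => B.a_adj_s_le n _

/-- `H₀^{-1/2}`. -/
def S : lp h 2 →L[ℂ] lp h 2 := lpOp id Function.injective_id s 1 B.s_le'

/-- `H₀^{-1/2} a(v) H₀^{-1/2}`. -/
def G : lp h 2 →L[ℂ] lp h 2 :=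
  lpOp (· + 1) (add_left_injective 1) (fun n => (s n).comp (a n)) C B.s_a_le

theorem S_apply (g : lp h 2) (n : ℕ) : B.S g n = s n (g n) := rfl

theorem G_apply (g : lp h 2) (n : ℕ) : B.G g n = s n (a n (g (n + 1))) := rfl

theorem S_symm (x y : lp h 2) : inner ℂ (B.S x) y = inner ℂ x (B.S y) := by
  simp only [lp.inner_eq_tsum, S_apply, B.symm]

theorem S_injective : Function.Injective B.S := by
  rw [injective_iff_map_eq_zero]
  intro g hg
  ext n
  refine B.inj n _ ?_
  rw [← B.S_apply, hg]
  rfl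

/-- Testing against vectors supported on one level isolates that component. Level 0 gives zero
because `G` never reads the vacuum component. -/
theorem G_adjoint_apply (g : lp h 2) (n : ℕ) :
    B.G.adjoint g n = raise a (B.S g : ∀ n, h n) n := by
  refine ext_inner_left ℂ fun x => ?_
  classical
  rw [← lp.inner_single_left, ContinuousLinearMap.adjoint_inner_right, lp.inner_eq_tsum]
  cases n with
  | zero =>
    have : ∀ m, B.G (lp.single 2 0 x) m = 0 := fun m => by
      rw [G_apply, lp.single_apply_ne _ _ _ (Nat.succ_ne_zero m), map_zero, map_zero]
    simp [this, raise]
  | succ k =>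
    rw [tsum_eq_single k]
    · rw [G_apply, lp.single_apply_self, raise, ContinuousLinearMap.adjoint_inner_right, S_apply,
        B.symm]
    · intro m hm
      rw [G_apply, lp.single_apply_ne, map_zero, map_zero, inner_zero_left]
      simpa using hm

/-- `1 + β (H₀^{-1/2} a(v) H₀^{-1/2} + h.c.)`. -/
def L (β : ℝ) : lp h 2 →L[ℂ] lp h 2 :=
  ContinuousLinearMap.id ℂ _ + (β : ℂ) • (B.G + B.G.adjoint)

theorem L_apply (β : ℝ) (g : lp h 2) : B.L β g = g + (β : ℂ) • (B.G g + B.G.adjoint g) := rfl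

theorem L_apply_apply (β : ℝ) (g : lp h 2) (n : ℕ) :
    B.L β g n = g n + (β : ℂ) • (s n (a n (g (n + 1))) + raise a (B.S g : ∀ n, h n) n) := by
  rw [← B.G_adjoint_apply, ← B.G_apply]
  rfl

theorem L_symm (β : ℝ) (x y : lp h 2) : inner ℂ (B.L β x) y = inner ℂ x (B.L β y) := by
  simp only [L_apply, inner_add_left, inner_add_right, inner_smul_left, inner_smul_right,
    Complex.conj_ofReal, ContinuousLinearMap.adjoint_inner_left,
    ContinuousLinearMap.adjoint_inner_right]
  ring

theorem re_inner_L (β : ℝ) (g : lp h 2) :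
    (inner ℂ g (B.L β g)).re = ‖g‖ ^ 2 + 2 * β * (inner ℂ g (B.G g)).re := by
  have e : (inner ℂ g g).re = ‖g‖ ^ 2 := (norm_sq_eq_re_inner (𝕜 := ℂ) g).symm
  rw [L_apply, inner_add_right, inner_smul_right, inner_add_right,
    ContinuousLinearMap.adjoint_inner_right, ← inner_conj_symm (B.G g) g, Complex.add_conj,
    Complex.add_re, e, Complex.re_ofReal_mul, Complex.ofReal_re]
  ring

theorem inner_G_term (g : lp h 2) (n : ℕ) :
    inner ℂ (g n) (B.G g n) = inner ℂ (s n (g n)) (a n (g (n + 1))) := by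
  rw [G_apply, B.symm]

/-- The n-th interaction term is at most 2|β| C rₙ ‖s gₙ‖ ‖gₙ₊₁‖. Splitting off ‖gₙ₊₁‖²/4 leaves
4β²C² rₙ² ‖s gₙ‖², where rₙ² ‖s gₙ‖ ≤ ‖gₙ‖ trades the growing weight for one factor ‖gₙ‖. A second
splitting leaves ‖gₙ‖²/4 and 16β⁴C⁴ ‖s gₙ‖²; the two quarters cost half of ‖g‖². -/
theorem L_coercive (β : ℝ) (g : lp h 2) :
    1 / 2 * ‖g‖ ^ 2 ≤ (inner ℂ g (B.L β g)).re + 16 * β ^ 4 * C ^ 4 * ‖B.S g‖ ^ 2 := by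
  rw [re_inner_L]
  have h1 := Complex.hasSum_re (lp.hasSum_inner g (B.G g))
  have h2 := hasSum_norm_sq g
  have h3 := hasSum_norm_sq (B.S g)
  have h4 : Summable fun n => ‖g (n + 1)‖ ^ 2 :=
    (summable_nat_add_iff (f := fun n => ‖g n‖ ^ 2) 1).2 h2.summable
  have h5 : ∑' n, ‖g (n + 1)‖ ^ 2 ≤ ‖g‖ ^ 2 := by
    rw [norm_sq_eq_tsum]
    exact tsum_comp_le_tsum_of_inj h2.summable (fun n => by positivity) (add_left_injective 1)
  have key := hasSum_le (fun n => ?_) (h1.mul_left (-(2 * β)))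
    (((h4.hasSum.mul_left (1 / 4)).add (h2.mul_left (1 / 4))).add
      (h3.mul_left (16 * β ^ 4 * C ^ 4)))
  · linarith
  · rw [inner_G_term, S_apply]
    set x := ‖s n (g n)‖
    set y := ‖g (n + 1)‖
    set z := ‖g n‖
    have e1 : |(inner ℂ (s n (g n)) (a n (g (n + 1)))).re| ≤ x * (C * r n * y) :=
      (Complex.abs_re_le_norm _).trans ((norm_inner_le_norm _ _).trans
        (mul_le_mul_of_nonneg_left (B.a_le n _) (norm_nonneg _)))
    have e2 : r n ^ 2 * x ≤ z := B.s_le n _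
    have e3 : -(2 * β) * (inner ℂ (s n (g n)) (a n (g (n + 1)))).re
        ≤ 2 * |β| * (x * (C * r n * y)) := by
      refine (le_abs_self _).trans ?_
      rw [abs_mul, abs_neg, abs_mul, abs_two]
      exact mul_le_mul_of_nonneg_left e1 (by positivity)
    have e4 : 2 * |β| * (x * (C * r n * y)) ≤ 1 / 4 * y ^ 2 + 4 * β ^ 2 * C ^ 2 * (r n ^ 2 * x) * x := by
      have := sq_nonneg (1 / 2 * y - 2 * |β| * (x * (C * r n)))
      have hb : |β| ^ 2 = β ^ 2 := sq_abs β
      have : 0 ≤ 1 / 4 * y ^ 2 - 2 * |β| * (x * (C * r n * y))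
          + 4 * |β| ^ 2 * C ^ 2 * (r n ^ 2 * x) * x := by
        linarith
      rw [hb] at this
      linarith
    have e5 : 4 * β ^ 2 * C ^ 2 * (r n ^ 2 * x) * x ≤ 4 * β ^ 2 * C ^ 2 * z * x := by
      have : 0 ≤ x := norm_nonneg _
      gcongr
    have e6 := sq_nonneg (1 / 2 * z - 4 * β ^ 2 * C ^ 2 * x)
    linarith

/-- If `Ψ + β H₀⁻¹ a*(v) Ψ = H₀⁻¹ X` then `Ψ` is in the form domain. -/
theorem exists_S_eq (β : ℝ) (Ψ X : lp h 2)
    (hX : ∀ n, Ψ n + (β : ℂ) • s n (raise a (Ψ : ∀ n, h n) n) = s n (s n (X n))) :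
    ∃ g, B.S g = Ψ ∧ ∀ n, g n = s n (X n) - (β : ℂ) • raise a (Ψ : ∀ n, h n) n := by
  have hΨ : ∀ n, Ψ n = s n (s n (X n) - (β : ℂ) • raise a (Ψ : ∀ n, h n) n) := fun n => by
    rw [map_sub, map_smul, ← hX n, add_sub_cancel_right]
  have hs : ∀ n, ‖s n (X n)‖ ≤ ‖X n‖ := fun n => by simpa using B.s_le' n (X n)
  have hXm := memℓp_two_succ_iff.2 (memℓp_two_norm (lp.memℓp X))
  -- First bootstrap: s gains r⁻² and a† loses r, so Ψ has one power of r more than was assumed.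
  have h1 : Memℓp (fun n => r n * ‖Ψ n‖) 2 := by
    rw [← memℓp_two_succ_iff]
    refine memℓp_two_of_le (hXm.add ((memℓp_two_norm (lp.memℓp Ψ)).const_mul (|β| * C)))
      fun n => ?_
    rw [norm_mul, norm_norm, Real.norm_of_nonneg (B.pos _).le]
    simp only [Pi.add_apply]
    have e1 := B.r_s_le (n + 1) (s (n + 1) (X (n + 1))
      - (β : ℂ) • raise a (Ψ : ∀ n, h n) (n + 1))
    rw [← hΨ] at e1
    refine e1.trans ?_
    rw [inv_mul_eq_div, div_le_iff₀ (B.pos _)]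
    refine (norm_sub_le _ _).trans ?_
    rw [norm_smul, Complex.norm_real, Real.norm_eq_abs, raise]
    have e2 := B.adj_le n (Ψ n)
    have e3 := B.mono n
    have e4 := B.one_le (n + 1)
    have e5 : C * r n * ‖Ψ n‖ ≤ C * r (n + 1) * ‖Ψ n‖ := by
      have := B.nonneg
      gcongr
    calc _ ≤ ‖X (n + 1)‖ * r (n + 1) + |β| * (C * r (n + 1) * ‖Ψ n‖) := by
          refine add_le_add ((hs _).trans (le_mul_of_one_le_right (norm_nonneg _) e4)) ?_
          exact mul_le_mul_of_nonneg_left (e2.trans e5) (abs_nonneg _)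
      _ = _ := by ring
  -- Second bootstrap: the weight just gained absorbs the growth of a†, so the candidate preimage is
  -- square summable.
  have h2 : Memℓp (fun n => s n (X n) - (β : ℂ) • raise a (Ψ : ∀ n, h n) n) 2 := by
    rw [← memℓp_two_succ_iff]
    refine memℓp_two_of_le (hXm.add (h1.const_mul (|β| * C))) fun n => ?_
    refine (norm_sub_le _ _).trans (add_le_add (hs _) ?_)
    rw [norm_smul, Complex.norm_real, Real.norm_eq_abs, raise]
    exact (mul_le_mul_of_nonneg_left (B.adj_le n _) (abs_nonneg _)).trans_eq (by ring)
  exact ⟨⟨_, h2⟩, lp.ext (funext fun n => (hΨ n).symm), fun n => rfl⟩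

/-- The bound for a alone grows with n. Solving the equation for g turns a g into a combination of a
s η, a s a g and a a† s g, and each of these products is bounded uniformly in n. -/
theorem memℓp_a_of_L_eq (β : ℝ) (g η : lp h 2) (hg : B.L β g = B.S η) :
    Memℓp (fun n => a n (g (n + 1))) 2 := by
  have hgn : ∀ n, g (n + 1) = s (n + 1) (η (n + 1)) - (β : ℂ) • s (n + 1) (a (n + 1) (g (n + 2)))
      - (β : ℂ) • (a n).adjoint (s n (g n)) := fun n => by
    rw [← B.S_apply, ← hg, L_apply_apply, smul_add, raise, B.S_apply]
    abel
  have m0 := memℓp_two_norm (lp.memℓp g)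
  have m1 := memℓp_two_succ_iff.2 (memℓp_two_norm (lp.memℓp η))
  have m2 := memℓp_two_succ_iff.2 (memℓp_two_succ_iff.2 m0)
  refine memℓp_two_of_le (((m1.const_mul C).add (m2.const_mul (|β| * C ^ 2))).add
    (m0.const_mul (|β| * C ^ 2))) fun n => ?_
  rw [hgn, map_sub, map_sub, map_smul, map_smul]
  refine (norm_sub_le _ _).trans (add_le_add ((norm_sub_le _ _).trans (add_le_add ?_ ?_)) ?_)
  · exact B.a_s_le' n _
  · rw [norm_smul, Complex.norm_real, Real.norm_eq_abs]
    exact (mul_le_mul_of_nonneg_left (B.a_s_a_le n _) (abs_nonneg _)).trans_eq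
      (mul_assoc _ _ _).symm
  · rw [norm_smul, Complex.norm_real, Real.norm_eq_abs]
    exact (mul_le_mul_of_nonneg_left (B.a_adj_s_le n _) (abs_nonneg _)).trans_eq
      (mul_assoc _ _ _).symm

/-- The equation `L g = H₀^{-1/2} η` in terms of `Ψ = H₀^{-1/2} g`. -/
theorem L_eq_S_iff (β : ℝ) (Ψ η : lp h 2) : (∃ g, B.S g = Ψ ∧ B.L β g = B.S η) ↔
    ∃ X g : lp h 2, B.S g = Ψ ∧
      (∀ n, Ψ n + (β : ℂ) • s n (raise a (Ψ : ∀ n, h n) n) = s n (s n (X n))) ∧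
      ∀ n, η n = X n + (β : ℂ) • a n (g (n + 1)) := by
  constructor
  · rintro ⟨g, rfl, hg⟩
    -- X is forced by the last equation; it lies in the Hilbert sum by `memℓp_a_of_L_eq`.
    refine ⟨η - (β : ℂ) • ⟨_, B.memℓp_a_of_L_eq β g η hg⟩, g, rfl, fun n => ?_, fun n => ?_⟩
    · have := congrArg (fun f : lp h 2 => f n) hg
      simp only [L_apply_apply, B.S_apply η] at this
      change _ = s n (s n (η n - (β : ℂ) • a n (g (n + 1))))
      rw [map_sub, ← this, map_smul, smul_add, B.S_apply, ← map_smul, ← map_add]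
      congr 1
      abel
    · exact (sub_add_cancel _ _).symm
  · rintro ⟨X, g, rfl, hX, hη⟩
    refine ⟨g, rfl, lp.ext (funext fun n => ?_)⟩
    have hgn : g n = s n (X n) - (β : ℂ) • raise a (B.S g : ∀ n, h n) n := by
      rw [← sub_eq_zero]
      refine B.inj n _ ?_
      rw [map_sub, map_sub, map_smul, ← hX n, B.S_apply]
      abel
    rw [L_apply_apply, S_apply, hη, map_add, map_smul]
    nth_rewrite 1 [hgn]
    rw [smul_add]
    abel

end LadderBounds

end Ladder

/-! ### The form factor is square integrable against `H₀⁻¹` -/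

theorem integrableOn_inv_add_sq {m : ℝ} (hm : 0 < m) :
    IntegrableOn (fun y : ℝ => (m + y ^ 2)⁻¹) (Set.Ioi 0) ∧
    ∫ y in Set.Ioi (0 : ℝ), (m + y ^ 2)⁻¹ = Real.pi / 2 / √m := by
  have hs : 0 < √m := Real.sqrt_pos.2 hm
  have h1 : ∀ y : ℝ, (m + y ^ 2)⁻¹ = m⁻¹ * (1 + ((√m)⁻¹ * y) ^ 2)⁻¹ := fun y => by
    rw [← mul_inv, mul_add, mul_pow, inv_pow, Real.sq_sqrt hm.le, mul_one, ← mul_assoc,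
      mul_inv_cancel₀ hm.ne', one_mul]
  simp_rw [h1]
  have hi := integrable_inv_one_add_sq.comp_mul_left' (inv_ne_zero hs.ne')
  refine ⟨(hi.const_mul _).integrableOn, ?_⟩
  rw [integral_const_mul, integral_comp_mul_left_Ioi (fun y => (1 + y ^ 2)⁻¹) 0 (inv_pos.2 hs),
    mul_zero, integral_Ioi_inv_one_add_sq, Real.arctan_zero, sub_zero, inv_inv, smul_eq_mul]
  nth_rewrite 1 [← Real.sq_sqrt hm.le]
  field_simp

/-- In dimension three the Jacobian y² cancels the singularity |ξ|⁻², leaving the arctangent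
integral; the factor 3 |B₁| is the area of the unit sphere. -/
theorem lintegral_radial {m : ℝ} (hm : 0 < m) :
    ∫⁻ ξ : R3, ENNReal.ofReal ((‖ξ‖ ^ 2)⁻¹ * (‖ξ‖ ^ 2 + m)⁻¹)
      = ENNReal.ofReal (3 * volume.real (Metric.ball (0 : R3) 1) * (Real.pi / 2 / √m)) := by
  obtain ⟨h1, h2⟩ := integrableOn_inv_add_sq hm
  have hdim : Module.finrank ℝ R3 = 3 := by simp
  have hc : ∀ y ∈ Set.Ioi (0 : ℝ), (m + y ^ 2)⁻¹
      = y ^ (Module.finrank ℝ R3 - 1) • ((y ^ 2)⁻¹ * (y ^ 2 + m)⁻¹) := fun y hy => by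
    have : y ≠ 0 := ne_of_gt hy
    rw [hdim, smul_eq_mul, ← mul_assoc, mul_inv_cancel₀ (pow_ne_zero _ this), one_mul, add_comm]
  have h3 : Integrable (fun ξ : R3 => (‖ξ‖ ^ 2)⁻¹ * (‖ξ‖ ^ 2 + m)⁻¹) := by
    rw [integrable_fun_norm_addHaar volume (f := fun y : ℝ => (y ^ 2)⁻¹ * (y ^ 2 + m)⁻¹)]
    exact h1.congr_fun hc measurableSet_Ioi
  rw [← ofReal_integral_eq_lintegral_ofReal h3 (Eventually.of_forall fun ξ => by positivity),
    integral_fun_norm_addHaar volume (fun y : ℝ => (y ^ 2)⁻¹ * (y ^ 2 + m)⁻¹),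
    ← setIntegral_congr_fun measurableSet_Ioi hc, h2, hdim]
  congr 1
  simp only [nsmul_eq_mul, smul_eq_mul]
  push_cast
  ring

/-- Whichever of x and y is smaller may replace the other. With x = |ξ|² and y = |ξ - p|² this
separates the two centres of the integrand, and translation invariance then gives a bound
independent of p. -/
theorem inv_mul_inv_le_add {x y m : ℝ} (hx : 0 < x) (hy : 0 < y) (hm : 0 < m) :
    x⁻¹ * (y + m)⁻¹ ≤ x⁻¹ * (x + m)⁻¹ + y⁻¹ * (y + m)⁻¹ := by
  rcases le_total x y with h | h
  · have : x⁻¹ * (y + m)⁻¹ ≤ x⁻¹ * (x + m)⁻¹ := by gcongr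
    have : 0 ≤ y⁻¹ * (y + m)⁻¹ := by positivity
    linarith
  · have : x⁻¹ * (y + m)⁻¹ ≤ y⁻¹ * (y + m)⁻¹ := by gcongr
    have : 0 ≤ x⁻¹ * (x + m)⁻¹ := by positivity
    linarith

/-- The constant in `lintegral_vhat_sq_le`. -/
def vconst : ℝ :=
  (4 * Real.pi)⁻¹ ^ 2 * (2 * (3 * volume.real (Metric.ball (0 : R3) 1) * (Real.pi / 2)))

theorem vconst_nonneg : 0 ≤ vconst := by
  unfold vconst
  positivity

theorem lintegral_vhat_sq_le (p : R3) {m : ℝ} (hm : 0 < m) :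
    ∫⁻ ξ : R3, ENNReal.ofReal (vhat ξ ^ 2 * (‖p - ξ‖ ^ 2 + m)⁻¹)
      ≤ ENNReal.ofReal (vconst / √m) := by
  have hv : ∀ ξ : R3, vhat ξ ^ 2 = (4 * Real.pi)⁻¹ ^ 2 * (‖ξ‖ ^ 2)⁻¹ := fun ξ => by
    rw [vhat, one_div, mul_inv, mul_pow, inv_pow ‖ξ‖]
  -- The convention 0⁻¹ = 0 can break the pointwise bound at ξ = p; the points 0 and p are null
  -- sets.
  have hne : ∀ q : R3, ∀ᵐ ξ : R3, ξ ≠ q := fun q => by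
    simp [ae_iff]
  have hF : Measurable fun ξ : R3 => ENNReal.ofReal ((‖ξ‖ ^ 2)⁻¹ * (‖ξ‖ ^ 2 + m)⁻¹) := by
    fun_prop
  calc ∫⁻ ξ : R3, ENNReal.ofReal (vhat ξ ^ 2 * (‖p - ξ‖ ^ 2 + m)⁻¹)
      ≤ ∫⁻ ξ : R3, ENNReal.ofReal ((4 * Real.pi)⁻¹ ^ 2) *
          (ENNReal.ofReal ((‖ξ‖ ^ 2)⁻¹ * (‖ξ‖ ^ 2 + m)⁻¹)
            + ENNReal.ofReal ((‖ξ - p‖ ^ 2)⁻¹ * (‖ξ - p‖ ^ 2 + m)⁻¹)) := by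
        refine lintegral_mono_ae ?_
        filter_upwards [hne 0, hne p] with ξ h0 hp
        rw [← ENNReal.ofReal_add (by positivity) (by positivity),
          ← ENNReal.ofReal_mul (by positivity), hv, mul_assoc, norm_sub_rev p ξ]
        refine ENNReal.ofReal_le_ofReal (mul_le_mul_of_nonneg_left ?_ (by positivity))
        have h1 : 0 < ‖ξ‖ := norm_pos_iff.2 h0
        have h2 : 0 < ‖ξ - p‖ := norm_pos_iff.2 (sub_ne_zero.2 hp)
        exact inv_mul_inv_le_add (by positivity) (by positivity) hm
    _ = ENNReal.ofReal (vconst / √m) := by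
        rw [lintegral_const_mul _ (by fun_prop), lintegral_add_left hF,
          lintegral_sub_right_eq_self
            (fun ξ : R3 => ENNReal.ofReal ((‖ξ‖ ^ 2)⁻¹ * (‖ξ‖ ^ 2 + m)⁻¹)) p,
          lintegral_radial hm, ← ENNReal.ofReal_add (by positivity) (by positivity),
          ← ENNReal.ofReal_mul (by positivity), vconst]
        congr 1
        ring

/-! ### Square integrable functions and bosonic operators -/

theorem eLpNorm_two_sq {X : Type*} [MeasurableSpace X] (μ : Measure X) (f : X → ℂ) :
    eLpNorm f 2 μ ^ 2 = ∫⁻ x, ‖f x‖ₑ ^ 2 ∂μ := by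
  have := eLpNorm_nnreal_pow_eq_lintegral (f := f) (μ := μ) (p := 2) (by norm_num)
  simpa only [NNReal.coe_ofNat, ENNReal.coe_ofNat, ENNReal.rpow_two] using this

theorem memLp_two_of_lintegral {X : Type*} [MeasurableSpace X] {μ : Measure X} {f : X → ℂ}
    (hf : AEStronglyMeasurable f μ) (h : ∫⁻ x, ‖f x‖ₑ ^ 2 ∂μ < ⊤) : MemLp f 2 μ := by
  refine ⟨hf, ?_⟩
  rw [← eLpNorm_two_sq] at h
  exact (ENNReal.pow_lt_top_iff.1 h).resolve_right (by norm_num)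

theorem lintegral_sq_lt_top {X : Type*} [MeasurableSpace X] {μ : Measure X} {f : X → ℂ}
    (hf : MemLp f 2 μ) : ∫⁻ x, ‖f x‖ₑ ^ 2 ∂μ < ⊤ := by
  rw [← eLpNorm_two_sq]
  exact ENNReal.pow_lt_top hf.2

theorem norm_sq_eq_lintegral {X : Type*} [MeasurableSpace X] {μ : Measure X} (f : Lp ℂ 2 μ) :
    ENNReal.ofReal (‖f‖ ^ 2) = ∫⁻ x, ‖f x‖ₑ ^ 2 ∂μ := by
  rw [← eLpNorm_two_sq, Lp.norm_def, ← ENNReal.toReal_pow,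
    ENNReal.ofReal_toReal (ENNReal.pow_ne_top (Lp.eLpNorm_ne_top f))]

theorem lintegral_mul_sq_le {X : Type*} [MeasurableSpace X] {μ : Measure X} {f g : X → ENNReal}
    (hf : AEMeasurable f μ) (hg : AEMeasurable g μ) :
    (∫⁻ x, f x * g x ∂μ) ^ 2 ≤ (∫⁻ x, f x ^ 2 ∂μ) * ∫⁻ x, g x ^ 2 ∂μ := by
  have h := ENNReal.lintegral_mul_le_Lp_mul_Lq μ Real.HolderConjugate.two_two hf hg
  have e : ∀ z : ENNReal, (z ^ (1 / (2 : ℝ))) ^ 2 = z := fun z => by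
    rw [← ENNReal.rpow_natCast, ← ENNReal.rpow_mul]
    norm_num
  calc (∫⁻ x, f x * g x ∂μ) ^ 2 ≤ _ := pow_le_pow_left' h 2
    _ = _ := by
      rw [mul_pow, e, e]
      simp only [ENNReal.rpow_two]

theorem mem_bosons_iff {n : ℕ} (f : L2n n) :
    f ∈ bosons n ↔ ∀ σ : Equiv.Perm (Fin n), (fun k => f (k ∘ σ)) =ᵐ[volume] f := by
  refine forall_congr' fun σ => ?_
  have h : permAct σ f =ᵐ[volume] fun k => f (k ∘ σ) :=
    Lp.coeFn_compMeasurePreserving f (measurePreserving_perm σ)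
  constructor
  · intro h1
    rw [h1] at h
    exact h.symm
  · intro h1
    exact Lp.ext (h.trans h1)

theorem bosons_comp_perm {n : ℕ} (f : bosons n) (σ : Equiv.Perm (Fin n)) :
    (fun k => (f : L2n n) (k ∘ σ)) =ᵐ[volume] (f : L2n n) := (mem_bosons_iff _).1 f.2 σ

theorem ae_comp_perm {n : ℕ} (σ : Equiv.Perm (Fin n)) {p : (Fin n → R3) → Prop}
    (h : ∀ᵐ k, p k) : ∀ᵐ k : Fin n → R3, p (k ∘ σ) :=
  (measurePreserving_perm σ).quasiMeasurePreserving.ae h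

theorem toLp_mem_bosons {n : ℕ} {F : (Fin n → R3) → ℂ} (hF : MemLp F 2 volume)
    (hs : ∀ σ : Equiv.Perm (Fin n), (fun k => F (k ∘ σ)) =ᵐ[volume] F) :
    hF.toLp F ∈ bosons n := by
  rw [mem_bosons_iff]
  intro σ
  filter_upwards [hs σ, hF.coeFn_toLp, ae_comp_perm σ hF.coeFn_toLp] with k h1 h2 h3
  rw [h2, h3, h1]

theorem bosons_ext {n : ℕ} {f g : bosons n} (h : (f : L2n n) =ᵐ[volume] (g : L2n n)) : f = g :=
  Subtype.ext (Lp.ext h)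

/-- A map between bosonic functions that is linear, bounded and symmetric almost everywhere defines
a bounded operator. -/
theorem exists_bosonOp {n m : ℕ} (T : bosons n → (Fin m → R3) → ℂ) (C : ℝ) (hC : 0 ≤ C)
    (hmeas : ∀ f, AEStronglyMeasurable (T f) volume)
    (hbound : ∀ f, ∫⁻ k, ‖T f k‖ₑ ^ 2
      ≤ ENNReal.ofReal (C ^ 2) * ∫⁻ k, ‖(f : L2n n) k‖ₑ ^ 2)
    (hsymm : ∀ f (σ : Equiv.Perm (Fin m)), (fun k => T f (k ∘ σ)) =ᵐ[volume] T f)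
    (hadd : ∀ f g, T (f + g) =ᵐ[volume] T f + T g)
    (hsmul : ∀ (c : ℂ) f, T (c • f) =ᵐ[volume] c • T f) :
    ∃ A : bosons n →L[ℂ] bosons m,
      (∀ f, ((A f : bosons m) : L2n m) =ᵐ[volume] T f) ∧ ∀ f, ‖A f‖ ≤ C * ‖f‖ := by
  have hmem : ∀ f, MemLp (T f) 2 volume := fun f => by
    refine memLp_two_of_lintegral (hmeas f) ((hbound f).trans_lt ?_)
    exact ENNReal.mul_lt_top ENNReal.ofReal_lt_top (lintegral_sq_lt_top (Lp.memLp _))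
  let A₀ : bosons n →ₗ[ℂ] bosons m :=
    { toFun := fun f => ⟨(hmem f).toLp _, toLp_mem_bosons (hmem f) (hsymm f)⟩
      map_add' := fun f g => by
        refine bosons_ext ?_
        refine (hmem _).coeFn_toLp.trans ((hadd f g).trans ?_)
        exact ((hmem f).coeFn_toLp.symm.add (hmem g).coeFn_toLp.symm).trans
          (Lp.coeFn_add _ _).symm
      map_smul' := fun c f => by
        refine bosons_ext ?_
        refine (hmem _).coeFn_toLp.trans ((hsmul c f).trans ?_)
        exact ((hmem f).coeFn_toLp.symm.const_smul c).trans (Lp.coeFn_smul _ _).symm }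
  have hA₀ : ∀ f, ((A₀ f : bosons m) : L2n m) =ᵐ[volume] T f := fun f => (hmem f).coeFn_toLp
  have hle : ∀ f, ‖A₀ f‖ ≤ C * ‖f‖ := fun f => by
    refine (sq_le_sq₀ (norm_nonneg _) (mul_nonneg hC (norm_nonneg _))).1 ?_
    rw [← ENNReal.ofReal_le_ofReal_iff (by positivity), mul_pow,
      ENNReal.ofReal_mul (by positivity), Submodule.coe_norm, Submodule.coe_norm,
      norm_sq_eq_lintegral, norm_sq_eq_lintegral]
    refine le_trans (le_of_eq (lintegral_congr_ae ?_)) (hbound f)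
    filter_upwards [hA₀ f] with k hk
    rw [hk]
  exact ⟨A₀.mkContinuous C hle, hA₀, hle⟩

/-! ### Splitting off the first momentum -/

theorem measurePreserving_cons (n : ℕ) :
    MeasurePreserving (fun z : R3 × (Fin n → R3) => (Fin.cons z.1 z.2 : Fin (n + 1) → R3))
      (volume.prod volume) volume := by
  have h := (volume_preserving_piFinSuccAbove (fun _ : Fin (n + 1) => R3) 0).symm
  convert! h using 1
  funext z
  simp [MeasurableEquiv.piFinSuccAbove, Fin.insertNthEquiv]

theorem measurable_cons (n : ℕ) :
    Measurable (fun z : R3 × (Fin n → R3) => (Fin.cons z.1 z.2 : Fin (n + 1) → R3)) :=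
  (measurePreserving_cons n).measurable

theorem lintegral_cons {n : ℕ} {F : (Fin (n + 1) → R3) → ENNReal} (hF : Measurable F) :
    ∫⁻ k, F k = ∫⁻ k : Fin n → R3, ∫⁻ ξ : R3, F (Fin.cons ξ k) := by
  rw [← (measurePreserving_cons n).lintegral_comp hF]
  exact lintegral_prod_symm _ (hF.comp (measurable_cons n)).aemeasurable

theorem integral_cons {n : ℕ} {F : (Fin (n + 1) → R3) → ℂ} (hF : Integrable F) :
    ∫ k, F k = ∫ k : Fin n → R3, ∫ ξ : R3, F (Fin.cons ξ k) := by
  have hmp := measurePreserving_cons n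
  have h1 : Integrable (fun z : R3 × (Fin n → R3) => F (Fin.cons z.1 z.2))
      (volume.prod volume) := hmp.integrable_comp_of_integrable hF
  have h2 : ∫ k, F k = ∫ z : R3 × (Fin n → R3), F (Fin.cons z.1 z.2) ∂(volume.prod volume) := by
    rw [← integral_map hmp.measurable.aemeasurable (by rw [hmp.map_eq]; exact hF.1), hmp.map_eq]
  rw [h2, integral_prod_symm _ h1]

theorem ae_tail {n : ℕ} {p : (Fin n → R3) → Prop} (h : ∀ᵐ k, p k) :
    ∀ᵐ k : Fin (n + 1) → R3, p (fun i => k i.succ) := by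
  simpa using ae_succAbove 0 h

/-! ### The operators on `n`-particle components -/

theorem energy_pos (P : R3) (n : ℕ) (k : Fin n → R3) : 0 < energy P n k := by
  unfold energy
  positivity

theorem le_energy (P : R3) (n : ℕ) (k : Fin n → R3) : (n : ℝ) + 1 ≤ energy P n k := by
  unfold energy
  have : 0 ≤ ‖P - ∑ j, k j‖ ^ 2 := by positivity
  linarith

theorem measurable_energy (P : R3) (n : ℕ) : Measurable (energy P n) := by
  unfold energy
  fun_prop

theorem energy_comp_perm (P : R3) {n : ℕ} (σ : Equiv.Perm (Fin n)) (k : Fin n → R3) :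
    energy P n (k ∘ σ) = energy P n k := by
  simp only [energy, Function.comp_apply, Equiv.sum_comp σ k]

/-- For frozen k the energy is |p - ξ|² + m with p = P - ∑ kⱼ and m = n + 2; since p ranges over all
momenta, the bound on the form factor has to be uniform in p. -/
theorem energy_cons (P : R3) {n : ℕ} (ξ : R3) (k : Fin n → R3) :
    energy P (n + 1) (Fin.cons ξ k) = ‖(P - ∑ j, k j) - ξ‖ ^ 2 + ((n : ℝ) + 2) := by
  simp only [energy, Fin.sum_univ_succ, Fin.cons_zero, Fin.cons_succ]
  rw [add_comm ξ, sub_add_eq_sub_sub]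
  push_cast
  ring

/-- The function `((P - ∑ⱼ kⱼ)² + n + 1)^{-1/2}`. -/
def einv (P : R3) (n : ℕ) (k : Fin n → R3) : ℝ := (√(energy P n k))⁻¹

theorem einv_pos (P : R3) (n : ℕ) (k : Fin n → R3) : 0 < einv P n k :=
  inv_pos.2 (Real.sqrt_pos.2 (energy_pos P n k))

theorem einv_sq (P : R3) (n : ℕ) (k : Fin n → R3) : einv P n k ^ 2 = (energy P n k)⁻¹ := by
  rw [einv, inv_pow, Real.sq_sqrt (energy_pos P n k).le]

theorem measurable_einv (P : R3) (n : ℕ) : Measurable (einv P n) :=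
  (measurable_energy P n).sqrt.inv

theorem einv_comp_perm (P : R3) {n : ℕ} (σ : Equiv.Perm (Fin n)) (k : Fin n → R3) :
    einv P n (k ∘ σ) = einv P n k := by
  rw [einv, einv, energy_comp_perm]

theorem measurable_vhat : Measurable vhat := by
  unfold vhat
  fun_prop

theorem measurable_coe {n : ℕ} (f : L2n n) : Measurable f := (Lp.stronglyMeasurable f).measurable

theorem enorm_ofReal_mul_sq (x : ℝ) (z : ℂ) :
    ‖(x : ℂ) * z‖ₑ ^ 2 = ENNReal.ofReal (x ^ 2) * ‖z‖ₑ ^ 2 := by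
  rw [enorm_mul, mul_pow]
  congr 1
  rw [← ofReal_norm, ← ENNReal.ofReal_pow (norm_nonneg _), Complex.norm_real, Real.norm_eq_abs,
    sq_abs]

theorem exists_invSqrt (P : R3) (n : ℕ) : ∃ A : bosons n →L[ℂ] bosons n,
    (∀ f, ((A f : bosons n) : L2n n) =ᵐ[volume] fun k => (einv P n k : ℂ) * (f : L2n n) k) ∧
    ∀ f, ‖A f‖ ≤ (√((n : ℝ) + 1))⁻¹ * ‖f‖ := by
  have hn : (0 : ℝ) < (n : ℝ) + 1 := by positivity
  have hc : 0 ≤ (√((n : ℝ) + 1))⁻¹ := by positivity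
  refine exists_bosonOp (n := n) (m := n) (fun f k => (einv P n k : ℂ) * (f : L2n n) k) (√((n : ℝ) + 1))⁻¹ hc
    (fun f => ?_) (fun f => ?_) (fun f σ => ?_) (fun f g => ?_) (fun c f => ?_)
  · exact ((Complex.measurable_ofReal.comp (measurable_einv P n)).mul
      (measurable_coe _)).aestronglyMeasurable
  · rw [← lintegral_const_mul _ ((measurable_coe (f : L2n n)).enorm.pow_const 2)]
    refine lintegral_mono fun k => ?_
    simp only
    rw [enorm_ofReal_mul_sq, einv_sq, inv_pow, Real.sq_sqrt hn.le]
    gcongr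
    exact le_energy P n k
  · filter_upwards [bosons_comp_perm f σ] with k hk
    rw [einv_comp_perm, hk]
  · filter_upwards [Lp.coeFn_add (f : L2n n) (g : L2n n)] with k hk
    simp only [Submodule.coe_add, Pi.add_apply, hk, mul_add]
  · filter_upwards [Lp.coeFn_smul c (f : L2n n)] with k hk
    simp only [Submodule.coe_smul, Pi.smul_apply, hk, smul_eq_mul]
    ring

/-- `H₀^{-1/2}` on the `n`-particle space. -/
def invSqrt (P : R3) (n : ℕ) : bosons n →L[ℂ] bosons n := (exists_invSqrt P n).choose

theorem invSqrt_coe (P : R3) {n : ℕ} (f : bosons n) :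
    ((invSqrt P n f : bosons n) : L2n n) =ᵐ[volume] fun k => (einv P n k : ℂ) * (f : L2n n) k :=
  (exists_invSqrt P n).choose_spec.1 f

theorem norm_invSqrt_le (P : R3) {n : ℕ} (f : bosons n) :
    ‖invSqrt P n f‖ ≤ (√((n : ℝ) + 1))⁻¹ * ‖f‖ := (exists_invSqrt P n).choose_spec.2 f

theorem invSqrt_symm (P : R3) {n : ℕ} (f g : bosons n) :
    inner ℂ (invSqrt P n f) g = inner ℂ f (invSqrt P n g) := by
  rw [Submodule.coe_inner, Submodule.coe_inner, L2.inner_def, L2.inner_def]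
  refine integral_congr_ae ?_
  filter_upwards [invSqrt_coe P f, invSqrt_coe P g] with k h1 h2
  simp only [h1, h2, RCLike.inner_apply, map_mul, Complex.conj_ofReal]
  ring

theorem eq_zero_of_invSqrt_eq_zero (P : R3) {n : ℕ} (f : bosons n) (h : invSqrt P n f = 0) :
    f = 0 := by
  refine bosons_ext ?_
  have h1 := invSqrt_coe P f
  rw [h] at h1
  filter_upwards [h1, Lp.coeFn_zero ℂ 2 (volume : Measure (Fin n → R3))] with k hk h0
  have h2 : ((0 : bosons n) : L2n n) k = 0 := h0
  rw [h2] at hk ⊢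
  refine (mul_eq_zero.1 hk.symm).resolve_left ?_
  exact_mod_cast (einv_pos P n k).ne'

/-- The integrand of `a(v) H₀^{-1/2} f`. -/
def annihKernel (P : R3) {n : ℕ} (f : L2n (n + 1)) (k : Fin n → R3) (ξ : R3) : ℂ :=
  (vhat ξ : ℂ) * ((einv P (n + 1) (Fin.cons ξ k) : ℂ) * f (Fin.cons ξ k))

/-- `a(v) H₀^{-1/2} f` as a function. -/
def annihFun (P : R3) {n : ℕ} (f : L2n (n + 1)) (k : Fin n → R3) : ℂ :=
  (√(n + 1) : ℝ) * ∫ ξ : R3, annihKernel P f k ξ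

theorem measurable_annihKernel (P : R3) {n : ℕ} (f : L2n (n + 1)) :
    Measurable fun z : (Fin n → R3) × R3 => annihKernel P f z.1 z.2 := by
  have h1 : Measurable fun z : (Fin n → R3) × R3 => (Fin.cons z.2 z.1 : Fin (n + 1) → R3) :=
    (measurable_cons n).comp measurable_swap
  have h2 := (measurable_coe f).comp h1
  have h3 := (measurable_einv P (n + 1)).comp h1
  have h4 : Measurable fun z : (Fin n → R3) × R3 => vhat z.2 := measurable_vhat.comp measurable_snd
  exact (Complex.measurable_ofReal.comp h4).mul ((Complex.measurable_ofReal.comp h3).mul h2)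

theorem lintegral_vhat_einv_sq_le (P : R3) {n : ℕ} (k : Fin n → R3) :
    ∫⁻ ξ : R3, ENNReal.ofReal ((vhat ξ * einv P (n + 1) (Fin.cons ξ k)) ^ 2)
      ≤ ENNReal.ofReal (vconst / √((n : ℝ) + 2)) := by
  refine le_trans (le_of_eq (lintegral_congr fun ξ => ?_))
    (lintegral_vhat_sq_le (P - ∑ j, k j) (m := (n : ℝ) + 2) (by positivity))
  rw [mul_pow, einv_sq, energy_cons]

/-- Cauchy–Schwarz in ξ alone, with v̂ · energy^{-1/2} as one factor: v̂ is not square integrable,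
but this product is. -/
theorem lintegral_annihKernel_sq_le (P : R3) {n : ℕ} (f : L2n (n + 1)) (k : Fin n → R3) :
    (∫⁻ ξ : R3, ‖annihKernel P f k ξ‖ₑ) ^ 2
      ≤ ENNReal.ofReal (vconst / √((n : ℝ) + 2)) * ∫⁻ ξ : R3, ‖f (Fin.cons ξ k)‖ₑ ^ 2 := by
  have hc : Measurable fun ξ : R3 => (Fin.cons ξ k : Fin (n + 1) → R3) :=
    (measurable_cons n).comp (measurable_id.prodMk measurable_const)
  have h1 : Measurable fun ξ : R3 => ‖f (Fin.cons ξ k)‖ₑ := ((measurable_coe f).comp hc).enorm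
  have h2 : Measurable fun ξ : R3 => ‖vhat ξ * einv P (n + 1) (Fin.cons ξ k)‖ₑ :=
    (measurable_vhat.mul ((measurable_einv P (n + 1)).comp hc)).enorm
  have h3 : ∀ ξ : R3, ‖annihKernel P f k ξ‖ₑ
      = ‖vhat ξ * einv P (n + 1) (Fin.cons ξ k)‖ₑ * ‖f (Fin.cons ξ k)‖ₑ := fun ξ => by
    rw [annihKernel, ← mul_assoc, enorm_mul, ← Complex.ofReal_mul, ← ofReal_norm,
      Complex.norm_real, ofReal_norm]
  simp_rw [h3]
  refine (lintegral_mul_sq_le h2.aemeasurable h1.aemeasurable).trans ?_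
  gcongr
  refine le_trans (le_of_eq (lintegral_congr fun ξ => ?_)) (lintegral_vhat_einv_sq_le P k)
  rw [← ofReal_norm, ← ENNReal.ofReal_pow (norm_nonneg _), Real.norm_eq_abs, sq_abs]

theorem ae_integrable_annihKernel (P : R3) {n : ℕ} (f : L2n (n + 1)) :
    ∀ᵐ k : Fin n → R3, Integrable (annihKernel P f k) := by
  have hf : Measurable fun k : Fin (n + 1) → R3 => ‖f k‖ₑ ^ 2 := (measurable_coe f).enorm.pow_const 2
  have h1 := lintegral_sq_lt_top (Lp.memLp f)
  rw [lintegral_cons hf] at h1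
  have hm : Measurable fun k : Fin n → R3 => ∫⁻ ξ : R3, ‖f (Fin.cons ξ k)‖ₑ ^ 2 :=
    (hf.comp ((measurable_cons n).comp measurable_swap)).lintegral_prod_right'
  filter_upwards [ae_lt_top hm h1.ne] with k hk
  refine ⟨((measurable_annihKernel P f).comp measurable_prodMk_left).aestronglyMeasurable, ?_⟩
  have h2 := (lintegral_annihKernel_sq_le P f k).trans_lt
    (ENNReal.mul_lt_top ENNReal.ofReal_lt_top hk)
  exact (ENNReal.pow_lt_top_iff.1 h2).resolve_right (by norm_num)

/-- The squared prefactor n + 1 of a(v) against the decay (n + 2)^{-1/2} leaves (n + 1)^{1/2}; its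
root is the weight rₙ = (n + 1)^{1/4}. -/
theorem sqrt_ratio_le (n : ℕ) : ((n : ℝ) + 1) * (vconst / √((n : ℝ) + 2))
    ≤ (√vconst * √(√((n : ℝ) + 1))) ^ 2 := by
  rw [mul_pow, Real.sq_sqrt vconst_nonneg, Real.sq_sqrt (Real.sqrt_nonneg _)]
  have h1 : (0 : ℝ) < √((n : ℝ) + 2) := Real.sqrt_pos.2 (by positivity)
  rw [mul_div_assoc', div_le_iff₀ h1, mul_assoc, mul_comm ((n : ℝ) + 1)]
  refine mul_le_mul_of_nonneg_left ?_ vconst_nonneg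
  calc (n : ℝ) + 1 = √((n : ℝ) + 1) * √((n : ℝ) + 1) := (Real.mul_self_sqrt (by positivity)).symm
    _ ≤ _ := by gcongr; norm_num

theorem exists_annihLevel (P : R3) (n : ℕ) : ∃ A : bosons (n + 1) →L[ℂ] bosons n,
    (∀ f, ((A f : bosons n) : L2n n) =ᵐ[volume] annihFun P (f : L2n (n + 1))) ∧
    ∀ f, ‖A f‖ ≤ √vconst * √(√((n : ℝ) + 1)) * ‖f‖ := by
  have hc : 0 ≤ √vconst * √(√((n : ℝ) + 1)) := by positivity
  refine exists_bosonOp (n := n + 1) (m := n) (fun f => annihFun P (f : L2n (n + 1))) (√vconst * √(√((n : ℝ) + 1))) hc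
    (fun f => ?_) (fun f => ?_) (fun f σ => ?_) (fun f g => ?_) (fun c f => ?_)
  · have h1 := (measurable_annihKernel P (f : L2n (n + 1))).stronglyMeasurable.integral_prod_right'
      (ν := (volume : Measure R3))
    exact (h1.const_mul _).aestronglyMeasurable
  · have hf : Measurable fun k : Fin (n + 1) → R3 => ‖(f : L2n (n + 1)) k‖ₑ ^ 2 :=
      (measurable_coe _).enorm.pow_const 2
    have hm : Measurable fun k : Fin n → R3 => ∫⁻ ξ : R3, ‖(f : L2n (n + 1)) (Fin.cons ξ k)‖ₑ ^ 2 :=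
      (hf.comp ((measurable_cons n).comp measurable_swap)).lintegral_prod_right'
    rw [lintegral_cons hf, ← lintegral_const_mul _ hm]
    refine lintegral_mono fun k => ?_
    simp only [annihFun]
    rw [enorm_ofReal_mul_sq, Real.sq_sqrt (by positivity)]
    calc ENNReal.ofReal ((n : ℝ) + 1) * ‖∫ ξ, annihKernel P (f : L2n (n + 1)) k ξ‖ₑ ^ 2
        ≤ ENNReal.ofReal ((n : ℝ) + 1) * (ENNReal.ofReal (vconst / √((n : ℝ) + 2))
          * ∫⁻ ξ : R3, ‖(f : L2n (n + 1)) (Fin.cons ξ k)‖ₑ ^ 2) := by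
          gcongr
          refine le_trans ?_ (lintegral_annihKernel_sq_le P _ k)
          exact pow_le_pow_left' (enorm_integral_le_lintegral_enorm _) 2
      _ ≤ _ := by
          rw [← mul_assoc, ← ENNReal.ofReal_mul (by positivity)]
          gcongr
          exact sqrt_ratio_le n
  -- A permutation of the n remaining momenta extends to one of n + 1 momenta that fixes the
  -- integrated one.
  · have h1 : ∀ ξ : R3, ∀ k : Fin n → R3, (Fin.cons ξ (k ∘ σ) : Fin (n + 1) → R3)
        = (Fin.cons ξ k : Fin (n + 1) → R3) ∘ Equiv.Perm.decomposeFin.symm (0, σ) := fun ξ k => by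
      funext i
      refine Fin.cases ?_ (fun i => ?_) i <;> simp
    filter_upwards [ae_cons (bosons_comp_perm f (Equiv.Perm.decomposeFin.symm (0, σ)))] with k hk
    simp only [annihFun]
    congr 1
    refine integral_congr_ae ?_
    filter_upwards [hk] with ξ hξ
    rw [annihKernel, annihKernel, h1, einv_comp_perm, hξ]
  · filter_upwards [ae_cons (Lp.coeFn_add (f : L2n (n + 1)) (g : L2n (n + 1))),
      ae_integrable_annihKernel P (f : L2n (n + 1)),
      ae_integrable_annihKernel P (g : L2n (n + 1))] with k hk h1 h2
    simp only [annihFun, Submodule.coe_add, Pi.add_apply]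
    rw [← mul_add, ← integral_add h1 h2]
    congr 1
    refine integral_congr_ae ?_
    filter_upwards [hk] with ξ hξ
    simp only [annihKernel, hξ, Pi.add_apply]
    ring
  · filter_upwards [ae_cons (Lp.coeFn_smul c (f : L2n (n + 1)))] with k hk
    simp only [annihFun, Submodule.coe_smul, Pi.smul_apply, smul_eq_mul]
    rw [mul_left_comm]
    congr 1
    rw [← integral_const_mul]
    refine integral_congr_ae ?_
    filter_upwards [hk] with ξ hξ
    simp only [annihKernel, hξ, Pi.smul_apply, smul_eq_mul]
    ring

/-- `a(v) H₀^{-1/2}` from the `n + 1`-particle to the `n`-particle space. -/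
def annihLevel (P : R3) (n : ℕ) : bosons (n + 1) →L[ℂ] bosons n := (exists_annihLevel P n).choose

theorem annihLevel_coe (P : R3) {n : ℕ} (f : bosons (n + 1)) :
    ((annihLevel P n f : bosons n) : L2n n) =ᵐ[volume] annihFun P (f : L2n (n + 1)) :=
  (exists_annihLevel P n).choose_spec.1 f

theorem norm_annihLevel_le (P : R3) {n : ℕ} (f : bosons (n + 1)) :
    ‖annihLevel P n f‖ ≤ √vconst * √(√((n : ℝ) + 1)) * ‖f‖ := (exists_annihLevel P n).choose_spec.2 f

theorem ladderBounds (P : R3) : LadderBounds (invSqrt P) (annihLevel P)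
    (fun n => √(√((n : ℝ) + 1))) (√vconst) where
  one_le n := by
    rw [Real.one_le_sqrt, Real.one_le_sqrt]
    have : (0 : ℝ) ≤ n := n.cast_nonneg
    linarith
  mono n := by
    refine Real.sqrt_le_sqrt (Real.sqrt_le_sqrt ?_)
    push_cast
    linarith
  nonneg := Real.sqrt_nonneg _
  symm n := invSqrt_symm P
  inj n := eq_zero_of_invSqrt_eq_zero P
  s_le n x := by
    have h1 := norm_invSqrt_le P x
    have h2 : 0 < √((n : ℝ) + 1) := Real.sqrt_pos.2 (by positivity)
    rw [Real.sq_sqrt (Real.sqrt_nonneg _)]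
    rwa [inv_mul_eq_div, le_div_iff₀ h2, mul_comm] at h1
  a_le n := norm_annihLevel_le P

/-! ### The adjoint of `a(v) H₀^{-1/2}` -/

/-- The term of `H₀^{-1/2} a*(v) f` that puts the new particle first. -/
def creatTerm (P : R3) {n : ℕ} (f : L2n n) (k : Fin (n + 1) → R3) : ℂ :=
  ((einv P (n + 1) k * vhat (k 0) : ℝ) : ℂ) * f (fun i => k i.succ)

theorem measurable_creatTerm (P : R3) {n : ℕ} (f : L2n n) : Measurable (creatTerm P f) := by
  have h1 : Measurable fun k : Fin (n + 1) → R3 => f (fun i => k i.succ) :=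
    (measurable_coe f).comp (measurable_pi_lambda _ fun i => measurable_pi_apply _)
  have h2 : Measurable fun k : Fin (n + 1) → R3 => einv P (n + 1) k * vhat (k 0) :=
    (measurable_einv P (n + 1)).mul (measurable_vhat.comp (measurable_pi_apply 0))
  exact (Complex.measurable_ofReal.comp h2).mul h1

/-- The energy factor makes the new particle square integrable uniformly in the other momenta, so
the ξ-integral can be done first. -/
theorem memLp_creatTerm (P : R3) {n : ℕ} (f : L2n n) : MemLp (creatTerm P f) 2 volume := by
  have hm := measurable_creatTerm P f
  refine memLp_two_of_lintegral hm.aestronglyMeasurable ?_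
  rw [lintegral_cons (hm.enorm.pow_const 2)]
  have hc : ∀ k : Fin n → R3, Measurable fun ξ : R3 => (Fin.cons ξ k : Fin (n + 1) → R3) :=
    fun k => (measurable_cons n).comp (measurable_id.prodMk measurable_const)
  calc ∫⁻ k : Fin n → R3, ∫⁻ ξ : R3, ‖creatTerm P f (Fin.cons ξ k)‖ₑ ^ 2
      ≤ ∫⁻ k : Fin n → R3, ENNReal.ofReal (vconst / √((n : ℝ) + 2)) * ‖f k‖ₑ ^ 2 := by
        refine lintegral_mono fun k => ?_
        have h1 : ∀ ξ : R3, ‖creatTerm P f (Fin.cons ξ k)‖ₑ ^ 2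
            = ENNReal.ofReal ((vhat ξ * einv P (n + 1) (Fin.cons ξ k)) ^ 2) * ‖f k‖ₑ ^ 2 :=
          fun ξ => by
            rw [creatTerm, enorm_ofReal_mul_sq, mul_comm (vhat ξ)]
            simp only [Fin.cons_zero, Fin.cons_succ]
        simp_rw [h1]
        have h2 : Measurable fun ξ : R3 =>
            ENNReal.ofReal ((vhat ξ * einv P (n + 1) (Fin.cons ξ k)) ^ 2) :=
          ((measurable_vhat.mul
            ((measurable_einv P (n + 1)).comp (hc k))).pow_const 2).ennreal_ofReal
        rw [lintegral_mul_const _ h2]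
        gcongr
        exact lintegral_vhat_einv_sq_le P k
    _ = ENNReal.ofReal (vconst / √((n : ℝ) + 2)) * ∫⁻ k : Fin n → R3, ‖f k‖ₑ ^ 2 :=
        lintegral_const_mul _ ((measurable_coe f).enorm.pow_const 2)
    _ < ⊤ := ENNReal.mul_lt_top ENNReal.ofReal_lt_top (lintegral_sq_lt_top (Lp.memLp f))

theorem creatTerm_comp_perm (P : R3) {n : ℕ} (f : bosons n) (π : Equiv.Perm (Fin (n + 1)))
    (hπ : π 0 = 0) :
    (fun k => creatTerm P (f : L2n n) (k ∘ π)) =ᵐ[volume] creatTerm P (f : L2n n) := by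
  obtain ⟨⟨p, τ⟩, rfl⟩ := Equiv.Perm.decomposeFin.symm.surjective π
  rw [Equiv.Perm.decomposeFin_symm_apply_zero] at hπ
  subst hπ
  filter_upwards [ae_tail (bosons_comp_perm f τ)] with k hk
  have h1 : (fun i : Fin n => (k ∘ Equiv.Perm.decomposeFin.symm (0, τ)) i.succ)
      = (fun i : Fin n => k i.succ) ∘ τ := by
    funext i
    simp
  rw [creatTerm, creatTerm, einv_comp_perm, h1, hk, Function.comp_apply,
    Equiv.Perm.decomposeFin_symm_apply_zero]

/-- Only the momentum given to the new particle matters: π'⁻¹π fixes 0, hence merely permutes the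
arguments of the symmetric f. -/
theorem creatTerm_comp_perm_congr (P : R3) {n : ℕ} (f : bosons n)
    (π π' : Equiv.Perm (Fin (n + 1))) (h : π 0 = π' 0) :
    (fun k => creatTerm P (f : L2n n) (k ∘ π))
      =ᵐ[volume] fun k => creatTerm P (f : L2n n) (k ∘ π') := by
  have h1 := creatTerm_comp_perm P f (π'⁻¹ * π) (by simp [h])
  filter_upwards [ae_comp_perm π' h1] with k hk
  rw [← hk]
  congr 1
  funext i
  simp

/-- `H₀^{-1/2} a*(v) f` as a function. -/
def creatFun (P : R3) {n : ℕ} (f : L2n n) (k : Fin (n + 1) → R3) : ℂ :=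
  -- `j.cycleRange.symm` moves kⱼ to the front and keeps the order of the others, which matches
  -- `succAbove` in `creat`.
  ((√((n : ℝ) + 1))⁻¹ : ℝ) * ∑ j : Fin (n + 1), creatTerm P f (k ∘ j.cycleRange.symm)

theorem memLp_creatTerm_comp (P : R3) {n : ℕ} (f : L2n n) (π : Equiv.Perm (Fin (n + 1))) :
    MemLp (fun k => creatTerm P f (k ∘ π)) 2 volume :=
  (memLp_creatTerm P f).comp_measurePreserving (measurePreserving_perm π)

theorem memLp_creatFun (P : R3) {n : ℕ} (f : L2n n) : MemLp (creatFun P f) 2 volume :=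
  (memLp_finsetSum _ fun _ _ => memLp_creatTerm_comp P f _).const_mul _

/-- Both σ after `j.cycleRange.symm` and `(σ j).cycleRange.symm` send 0 to σ j, so σ only reindexes
the sum. -/
theorem creatFun_comp_perm (P : R3) {n : ℕ} (f : bosons n) (σ : Equiv.Perm (Fin (n + 1))) :
    (fun k => creatFun P (f : L2n n) (k ∘ σ)) =ᵐ[volume] creatFun P (f : L2n n) := by
  have h : ∀ᵐ k : Fin (n + 1) → R3, ∀ j : Fin (n + 1),
      creatTerm P (f : L2n n) ((k ∘ σ) ∘ j.cycleRange.symm)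
        = creatTerm P (f : L2n n) (k ∘ (σ j).cycleRange.symm) :=
    ae_all_iff.2 fun j : Fin (n + 1) =>
      creatTerm_comp_perm_congr P f (j.cycleRange.symm.trans σ) (σ j).cycleRange.symm (by simp)
  filter_upwards [h] with k hk
  rw [creatFun, creatFun, Finset.sum_congr rfl fun j _ => hk j,
    Equiv.sum_comp σ fun j => creatTerm P (f : L2n n) (k ∘ j.cycleRange.symm)]

/-- `H₀^{-1/2} a*(v)` on the `n`-particle space. -/
def creatLevel (P : R3) {n : ℕ} (f : bosons n) : bosons (n + 1) :=
  ⟨(memLp_creatFun P (f : L2n n)).toLp _,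
    toLp_mem_bosons (memLp_creatFun P (f : L2n n)) (creatFun_comp_perm P f)⟩

theorem creatLevel_coe (P : R3) {n : ℕ} (f : bosons n) :
    ((creatLevel P f : bosons (n + 1)) : L2n (n + 1)) =ᵐ[volume] creatFun P (f : L2n n) :=
  (memLp_creatFun P (f : L2n n)).coeFn_toLp

theorem integral_comp_perm {n : ℕ} (σ : Equiv.Perm (Fin n)) {F : (Fin n → R3) → ℂ}
    (hF : AEStronglyMeasurable F volume) : ∫ k, F (k ∘ σ) = ∫ k, F k := by
  have hmp := measurePreserving_perm σ
  rw [← integral_map hmp.measurable.aemeasurable (by rwa [hmp.map_eq]), hmp.map_eq]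

/-- Fubini in the first momentum: the real factor v̂ · energy^{-1/2} can be read as acting on g
instead of f. -/
theorem integral_conj_creatTerm (P : R3) {n : ℕ} (f : bosons n) (g : bosons (n + 1)) :
    ((√((n : ℝ) + 1) : ℝ) : ℂ) *
      ∫ k, (starRingEnd ℂ) ((g : L2n (n + 1)) k) * creatTerm P (f : L2n n) k
      = inner ℂ (annihLevel P n g) f := by
  have hi : Integrable fun k => (starRingEnd ℂ) ((g : L2n (n + 1)) k) * creatTerm P (f : L2n n) k :=
    (Lp.memLp (g : L2n (n + 1))).star.integrable_mul (memLp_creatTerm P (f : L2n n))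
  rw [integral_cons hi, Submodule.coe_inner, L2.inner_def, ← integral_const_mul]
  refine integral_congr_ae ?_
  filter_upwards [annihLevel_coe P g] with k hk
  rw [hk, RCLike.inner_apply, annihFun, map_mul, Complex.conj_ofReal, ← integral_conj,
    mul_left_comm]
  congr 1
  rw [← integral_const_mul]
  refine integral_congr_ae (Eventually.of_forall fun ξ => ?_)
  simp only [annihKernel, creatTerm, Fin.cons_zero, Fin.cons_succ, map_mul, Complex.conj_ofReal]
  push_cast
  ring

/-- By the symmetry of g all n + 1 summands contribute equally, and (n + 1)/√(n + 1) is the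
prefactor √(n + 1) of a(v). -/
theorem inner_creatLevel (P : R3) {n : ℕ} (f : bosons n) (g : bosons (n + 1)) :
    inner ℂ g (creatLevel P f) = inner ℂ (annihLevel P n g) f := by
  have hi : ∀ j : Fin (n + 1), Integrable fun k => (starRingEnd ℂ) ((g : L2n (n + 1)) k)
      * creatTerm P (f : L2n n) (k ∘ j.cycleRange.symm) := fun j =>
    (Lp.memLp (g : L2n (n + 1))).star.integrable_mul (memLp_creatTerm_comp P (f : L2n n) _)
  have hj : ∀ j : Fin (n + 1), ∫ k, (starRingEnd ℂ) ((g : L2n (n + 1)) k)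
      * creatTerm P (f : L2n n) (k ∘ j.cycleRange.symm)
      = ∫ k, (starRingEnd ℂ) ((g : L2n (n + 1)) k) * creatTerm P (f : L2n n) k := fun j => by
    have hF : AEStronglyMeasurable (fun k => (starRingEnd ℂ) ((g : L2n (n + 1)) k)
        * creatTerm P (f : L2n n) k) volume :=
      ((Lp.memLp (g : L2n (n + 1))).star.integrable_mul (memLp_creatTerm P (f : L2n n))).1
    rw [← integral_comp_perm j.cycleRange.symm hF]
    refine integral_congr_ae ?_
    filter_upwards [bosons_comp_perm g j.cycleRange.symm] with k hk
    rw [hk]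
  have hn : ((√((n : ℝ) + 1) : ℝ) : ℂ) ≠ 0 := by
    exact_mod_cast (Real.sqrt_pos.2 (by positivity : (0 : ℝ) < n + 1)).ne'
  have hsq : ((n + 1 : ℕ) : ℂ) = ((√((n : ℝ) + 1) : ℝ) : ℂ) * ((√((n : ℝ) + 1) : ℝ) : ℂ) := by
    rw [← Complex.ofReal_mul, Real.mul_self_sqrt (by positivity)]
    push_cast
    rfl
  calc inner ℂ g (creatLevel P f)
      = ∫ k, ((√((n : ℝ) + 1))⁻¹ : ℝ) * ∑ j : Fin (n + 1), (starRingEnd ℂ) ((g : L2n (n + 1)) k)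
          * creatTerm P (f : L2n n) (k ∘ j.cycleRange.symm) := by
        rw [Submodule.coe_inner, L2.inner_def]
        refine integral_congr_ae ?_
        filter_upwards [creatLevel_coe P f] with k hk
        rw [hk, RCLike.inner_apply, creatFun, ← Finset.mul_sum]
        ring
    _ = ((√((n : ℝ) + 1))⁻¹ : ℝ) * (((n + 1 : ℕ) : ℂ) *
          ∫ k, (starRingEnd ℂ) ((g : L2n (n + 1)) k) * creatTerm P (f : L2n n) k) := by
        rw [integral_const_mul, integral_finsetSum _ fun j _ => hi j]
        simp only [hj, Finset.sum_const, Finset.card_univ, Fintype.card_fin, nsmul_eq_mul]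
    _ = _ := by
        rw [← integral_conj_creatTerm, hsq, Complex.ofReal_inv, ← mul_assoc, ← mul_assoc,
          inv_mul_cancel₀ hn, one_mul]

theorem adjoint_annihLevel (P : R3) {n : ℕ} (f : bosons n) :
    (annihLevel P n).adjoint f = creatLevel P f := by
  refine ext_inner_left ℂ fun g => ?_
  rw [ContinuousLinearMap.adjoint_inner_right, inner_creatLevel]

theorem creatFun_comp (P : R3) (Ψ : Fock) (n : ℕ) (k : Fin (n + 1) → R3) :
    creatFun P ((Ψ n : bosons n) : L2n n) k = (einv P (n + 1) k : ℂ) * creat Ψ (n + 1) k := by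
  simp only [creatFun, creatTerm, creat, einv_comp_perm, Function.comp_apply,
    Fin.cycleRange_symm_zero, Fin.cycleRange_symm_succ]
  rw [mul_left_comm]
  congr 1
  rw [Finset.mul_sum]
  refine Finset.sum_congr rfl fun j _ => ?_
  rw [Complex.ofReal_mul, mul_assoc]
  rfl

/-! ### Graphs of composite operators -/

section Graphs

variable {E : Type*} [AddCommGroup E] [Module ℂ E]

theorem mem_graph_iff_exists (f : E →ₗ.[ℂ] E) (x y : E) :
    (x, y) ∈ f.graph ↔ ∃ hx : x ∈ f.domain, f ⟨x, hx⟩ = y := by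
  rw [LinearPMap.mem_graph_iff]
  constructor
  · rintro ⟨z, rfl, h⟩
    exact ⟨z.2, h⟩
  · rintro ⟨hx, h⟩
    exact ⟨⟨x, hx⟩, rfl, h⟩

/-- On graphs, compositions with natural domains become existential statements, free of dependent
membership proofs. -/
theorem mem_pcomp_graph (g f : E →ₗ.[ℂ] E) (x z : E) :
    (x, z) ∈ (pcomp g f).graph ↔ ∃ y, (x, y) ∈ f.graph ∧ (y, z) ∈ g.graph := by
  simp only [mem_graph_iff_exists, mem_pcomp_domain]
  constructor
  · rintro ⟨⟨hx, hy⟩, h⟩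
    exact ⟨f ⟨x, hx⟩, ⟨hx, rfl⟩, hy, h⟩
  · rintro ⟨y, ⟨hx, rfl⟩, hy, h⟩
    exact ⟨⟨hx, hy⟩, h⟩

theorem mem_add_graph (f g : E →ₗ.[ℂ] E) (x z : E) :
    (x, z) ∈ (f + g).graph ↔ ∃ a b, (x, a) ∈ f.graph ∧ (x, b) ∈ g.graph ∧ a + b = z := by
  simp only [mem_graph_iff_exists]
  constructor
  · rintro ⟨⟨h1, h2⟩, h⟩
    exact ⟨_, _, ⟨h1, rfl⟩, ⟨h2, rfl⟩, h⟩
  · rintro ⟨a, b, ⟨h1, rfl⟩, ⟨h2, rfl⟩, h⟩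
    exact ⟨⟨h1, h2⟩, h⟩

theorem mem_smul_graph (c : ℂ) (f : E →ₗ.[ℂ] E) (x z : E) :
    (x, z) ∈ (c • f).graph ↔ ∃ y, (x, y) ∈ f.graph ∧ c • y = z := by
  simp only [mem_graph_iff_exists]
  constructor
  · rintro ⟨hx, h⟩
    exact ⟨_, ⟨hx, rfl⟩, h⟩
  · rintro ⟨y, ⟨hx, rfl⟩, h⟩
    exact ⟨hx, h⟩

theorem mem_neg_graph (f : E →ₗ.[ℂ] E) (x z : E) :
    (x, z) ∈ (-f).graph ↔ ∃ y, (x, y) ∈ f.graph ∧ -y = z := by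
  simp only [mem_graph_iff_exists]
  constructor
  · rintro ⟨hx, h⟩
    exact ⟨_, ⟨hx, rfl⟩, h⟩
  · rintro ⟨y, ⟨hx, rfl⟩, h⟩
    exact ⟨hx, h⟩

theorem mem_pone_graph (x z : E) : (x, z) ∈ (pone : E →ₗ.[ℂ] E).graph ↔ x = z := by
  rw [mem_graph_iff_exists]
  exact ⟨fun ⟨_, h⟩ => h, fun h => ⟨Submodule.mem_top, h⟩⟩

end Graphs

/-! ### The operators in components -/

theorem mem_multOp_graph (w : ∀ n : ℕ, (Fin n → R3) → ℝ) (Ψ Φ : Fock) :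
    (Ψ, Φ) ∈ (multOp w).graph ↔ ∀ n, ∀ᵐ k, comp Φ n k = (w n k : ℂ) * comp Ψ n k := by
  rw [multOp, Submodule.toLinearPMap_graph_eq _ (multGraph_singleValued w)]
  rfl

theorem bosons_eq_iff {n : ℕ} (f g : bosons n) :
    f = g ↔ ∀ᵐ k, (f : L2n n) k = (g : L2n n) k :=
  ⟨fun h => by rw [h]; exact Eventually.of_forall fun _ => rfl, bosons_ext⟩

theorem invSqrt_invSqrt_coe (P : R3) {n : ℕ} (f : bosons n) :
    ∀ᵐ k, ((invSqrt P n (invSqrt P n f) : bosons n) : L2n n) k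
      = ((energy P n k)⁻¹ : ℝ) * (f : L2n n) k := by
  filter_upwards [invSqrt_coe P (invSqrt P n f), invSqrt_coe P f] with k h1 h2
  rw [h1, h2, ← mul_assoc, ← Complex.ofReal_mul, ← pow_two, einv_sq]

theorem mem_H0sqrt_graph (P : R3) (Ψ g : Fock) :
    (Ψ, g) ∈ (H0sqrt P).graph ↔ (ladderBounds P).S g = Ψ := by
  rw [H0sqrt, mem_multOp_graph, lp.ext_iff, funext_iff]
  refine forall_congr' fun n => ?_
  rw [LadderBounds.S_apply, bosons_eq_iff]
  refine Filter.eventually_congr ?_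
  filter_upwards [invSqrt_coe P (g n)] with k h1
  have h2 : ((√(energy P n k) : ℝ) : ℂ) ≠ 0 := by
    exact_mod_cast (Real.sqrt_pos.2 (energy_pos P n k)).ne'
  rw [h1, einv, Complex.ofReal_inv, inv_mul_eq_iff_eq_mul₀ h2]
  rfl

theorem mem_H0_graph (P : R3) (Ψ X : Fock) :
    (Ψ, X) ∈ (H0 P).graph ↔ ∀ n, Ψ n = invSqrt P n (invSqrt P n (X n)) := by
  rw [H0, mem_multOp_graph]
  refine forall_congr' fun n => ?_
  rw [bosons_eq_iff]
  refine Filter.eventually_congr ?_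
  filter_upwards [invSqrt_invSqrt_coe P (X n)] with k h1
  have h2 : ((energy P n k : ℝ) : ℂ) ≠ 0 := by exact_mod_cast (energy_pos P n k).ne'
  rw [h1, Complex.ofReal_inv, eq_inv_mul_iff_mul_eq₀ h2]
  exact eq_comm

theorem mem_H0inv_graph (P : R3) (Ψ Φ : Fock) :
    (Ψ, Φ) ∈ (H0inv P).graph ↔ ∀ n, Φ n = invSqrt P n (invSqrt P n (Ψ n)) := by
  rw [H0inv, mem_multOp_graph]
  refine forall_congr' fun n => ?_
  rw [bosons_eq_iff]
  refine Filter.eventually_congr ?_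
  filter_upwards [invSqrt_invSqrt_coe P (Ψ n)] with k h1
  rw [h1]
  rfl

theorem annihIntegrand_ae_eq (P : R3) (Ψ : Fock) {n : ℕ} (f : bosons (n + 1))
    (h : Ψ (n + 1) = invSqrt P (n + 1) f) : ∀ᵐ k : Fin n → R3,
    (fun ξ : R3 => (vhat ξ : ℂ) * comp Ψ (n + 1) (Fin.cons ξ k))
      =ᵐ[volume] annihKernel P (f : L2n (n + 1)) k := by
  filter_upwards [ae_cons (invSqrt_coe P f)] with k hk
  filter_upwards [hk] with ξ hξ
  rw [annihKernel, ← hξ, comp, h]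

theorem annih_ae_eq (P : R3) (Ψ : Fock) {n : ℕ} (f : bosons (n + 1))
    (h : Ψ (n + 1) = invSqrt P (n + 1) f) :
    annih Ψ n =ᵐ[volume] ((annihLevel P n f : bosons n) : L2n n) := by
  filter_upwards [annihIntegrand_ae_eq P Ψ f h, annihLevel_coe P f] with k h1 h2
  rw [h2, annih, annihFun, integral_congr_ae h1]

theorem annihConv_of_eq (P : R3) (Ψ : Fock) (f : ∀ n, bosons (n + 1))
    (h : ∀ n, Ψ (n + 1) = invSqrt P (n + 1) (f n)) : AnnihConv Ψ := by
  intro n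
  filter_upwards [annihIntegrand_ae_eq P Ψ (f n) (h n),
    ae_integrable_annihKernel P (f n : L2n (n + 1))] with k h1 h2
  exact h2.congr h1.symm

/-- A levelwise preimage under H₀^{-1/2} already makes the integrals converge, with no summability
over n. The only remaining condition is that the values form a Fock vector, here Φ. -/
theorem mem_annihOp_graph (P : R3) (Ψ Φ : Fock) (f : ∀ n, bosons (n + 1))
    (h : ∀ n, Ψ (n + 1) = invSqrt P (n + 1) (f n)) :
    (Ψ, Φ) ∈ annihOp.graph ↔ ∀ n, Φ n = annihLevel P n (f n) := by
  rw [annihOp, Submodule.toLinearPMap_graph_eq _ annihGraph_singleValued]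
  refine Iff.trans (and_iff_right (annihConv_of_eq P Ψ f h)) (forall_congr' fun n => ?_)
  rw [bosons_eq_iff]
  refine Filter.eventually_congr ?_
  filter_upwards [annih_ae_eq P Ψ (f n) (h n)] with k h1
  rw [← h1]
  rfl

theorem raise_coe (P : R3) (Ψ : Fock) (n : ℕ) :
    ∀ᵐ k, ((raise (annihLevel P) (Ψ : ∀ n, bosons n) n : bosons n) : L2n n) k
      = (einv P n k : ℂ) * creat Ψ n k := by
  cases n with
  | zero =>
    filter_upwards [Lp.coeFn_zero ℂ 2 (volume : Measure (Fin 0 → R3))] with k hk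
    have h0 : ((raise (annihLevel P) (Ψ : ∀ n, bosons n) 0 : bosons 0) : L2n 0) k = 0 := hk
    rw [h0, creat, mul_zero]
  | succ n =>
    rw [raise, adjoint_annihLevel]
    filter_upwards [creatLevel_coe P (Ψ n)] with k hk
    rw [hk, creatFun_comp]

theorem mem_H0invCreat_graph (P : R3) (Ψ Φ : Fock) : (Ψ, Φ) ∈ (H0invCreat P).graph ↔
    ∀ n, Φ n = invSqrt P n (raise (annihLevel P) (Ψ : ∀ n, bosons n) n) := by
  rw [H0invCreat, Submodule.toLinearPMap_graph_eq _ (H0invCreatGraph_singleValued P)]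
  refine forall_congr' fun n => ?_
  rw [bosons_eq_iff]
  refine Filter.eventually_congr ?_
  filter_upwards [raise_coe P Ψ n,
    invSqrt_coe P (raise (annihLevel P) (Ψ : ∀ n, bosons n) n)] with k h1 h2
  rw [h2, h1, ← mul_assoc, ← Complex.ofReal_mul, ← pow_two, einv_sq]
  rfl

theorem H0invCreat_domain (P : R3) : (H0invCreat P).domain = ⊤ := by
  rw [Submodule.eq_top_iff']
  intro Ψ
  rw [LinearPMap.mem_domain_iff]
  exact ⟨⟨_, (ladderBounds P).memℓp_s_raise Ψ⟩, (mem_H0invCreat_graph P _ _).2 fun n => rfl⟩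

theorem mem_annihOp_H0inv_graph (P : R3) (X Z : Fock) :
    (X, Z) ∈ (pcomp annihOp (H0inv P)).graph ↔
      ∀ n, Z n = annihLevel P n (invSqrt P (n + 1) (X (n + 1))) := by
  simp only [mem_pcomp_graph, mem_H0inv_graph]
  constructor
  · rintro ⟨Y, hY, h⟩
    exact (mem_annihOp_graph P Y Z _ fun n => hY (n + 1)).1 h
  · intro h
    refine ⟨(ladderBounds P).S ((ladderBounds P).S X), fun n => rfl, ?_⟩
    exact (mem_annihOp_graph P _ Z (fun n => invSqrt P (n + 1) (X (n + 1))) fun n => rfl).2 h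

theorem annihOp_H0inv_domain (P : R3) : (pcomp annihOp (H0inv P)).domain = ⊤ := by
  rw [Submodule.eq_top_iff']
  intro X
  rw [LinearPMap.mem_domain_iff]
  exact ⟨⟨_, (ladderBounds P).memℓp_a_s X⟩, (mem_annihOp_H0inv_graph P _ _).2 fun n => rfl⟩

theorem mem_leftFactor_graph (α : ℝ) (P : R3) (X Z : Fock) :
    (X, Z) ∈ (leftFactor α P).graph ↔
      ∀ n, Z n = X n + ((√α : ℝ) : ℂ) • annihLevel P n (invSqrt P (n + 1) (X (n + 1))) := by
  simp only [leftFactor, mem_add_graph, mem_smul_graph, mem_pone_graph, mem_annihOp_H0inv_graph]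
  constructor
  · rintro ⟨_, _, rfl, ⟨Y, hY, rfl⟩, rfl⟩ n
    rw [← hY]
    rfl
  · intro h
    exact ⟨X, _, rfl, ⟨⟨_, (ladderBounds P).memℓp_a_s X⟩, fun n => rfl, rfl⟩,
      lp.ext (funext fun n => (h n).symm)⟩

theorem mem_rightFactor_graph (α : ℝ) (P : R3) (Ψ Φ : Fock) :
    (Ψ, Φ) ∈ (rightFactor α P).graph ↔ ∀ n, Φ n
      = Ψ n + ((√α : ℝ) : ℂ) • invSqrt P n (raise (annihLevel P) (Ψ : ∀ n, bosons n) n) := by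
  simp only [rightFactor, mem_add_graph, mem_smul_graph, mem_pone_graph, mem_H0invCreat_graph]
  constructor
  · rintro ⟨_, _, rfl, ⟨Y, hY, rfl⟩, rfl⟩ n
    rw [← hY]
    rfl
  · intro h
    exact ⟨Ψ, _, rfl, ⟨⟨_, (ladderBounds P).memℓp_s_raise Ψ⟩, fun n => rfl, rfl⟩,
      lp.ext (funext fun n => (h n).symm)⟩

/-- Restricted to Ψ = S g because the bound for a a† alone grows like rₙ²; the factor s in front of
g makes the product bounded. -/
theorem mem_T_graph (α : ℝ) (P : R3) (g Y : Fock) :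
    ((ladderBounds P).S g, Y) ∈ (T α P).graph ↔ ∀ n, Y n
      = -((α : ℂ) • annihLevel P n ((annihLevel P n).adjoint (invSqrt P n (g n)))) := by
  have key : ∀ Z : Fock, ((ladderBounds P).S g, Z) ∈ (pcomp annihOp (H0invCreat P)).graph ↔
      ∀ n, Z n = annihLevel P n ((annihLevel P n).adjoint (invSqrt P n (g n))) := fun Z => by
    simp only [mem_pcomp_graph, mem_H0invCreat_graph]
    constructor
    · rintro ⟨W, hW, h⟩
      exact (mem_annihOp_graph P W Z _ fun n => hW (n + 1)).1 h
    · intro h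
      refine ⟨⟨_, (ladderBounds P).memℓp_s_raise ((ladderBounds P).S g)⟩, fun n => rfl, ?_⟩
      exact (mem_annihOp_graph P _ Z
        (fun n => (annihLevel P n).adjoint (invSqrt P n (g n))) fun n => rfl).2 h
  simp only [T, mem_neg_graph, mem_smul_graph, key]
  constructor
  · rintro ⟨_, ⟨Z, hZ, rfl⟩, rfl⟩ n
    rw [← hZ]
    rfl
  · intro h
    exact ⟨_, ⟨⟨_, (ladderBounds P).memℓp_a_adj_s g⟩, fun n => rfl, rfl⟩,
      lp.ext (funext fun n => (h n).symm)⟩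

/-- The equation `(1 + √α H₀⁻¹ a*(v)) Ψ = H₀⁻¹ X` in components. -/
def RightEq (α : ℝ) (P : R3) (Ψ X : Fock) : Prop := ∀ n,
  Ψ n + ((√α : ℝ) : ℂ) • invSqrt P n (raise (annihLevel P) (Ψ : ∀ n, bosons n) n)
    = invSqrt P n (invSqrt P n (X n))

theorem exists_rightFactor_H0_iff (α : ℝ) (P : R3) (Ψ X : Fock) :
    (∃ Φ, (Ψ, Φ) ∈ (rightFactor α P).graph ∧ (Φ, X) ∈ (H0 P).graph) ↔ RightEq α P Ψ X := by
  simp only [mem_rightFactor_graph, mem_H0_graph]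
  constructor
  · rintro ⟨Φ, h1, h2⟩ n
    rw [← h1, h2]
  · intro h
    exact ⟨(ladderBounds P).S ((ladderBounds P).S X), fun n => (h n).symm, fun n => rfl⟩

/-! ### The graph of K + T -/

theorem add_smul_add_neg_mul_smul {E : Type*} [AddCommGroup E] [Module ℂ E] (c : ℂ) (x y z : E) :
    x + c • y + -((c * c) • z) = x + c • (y - c • z) := by
  module

theorem mem_K_graph (α : ℝ) (P : R3) (Ψ Z : Fock) :
    (Ψ, Z) ∈ (K α P).graph ↔ ∃ X, RightEq α P Ψ X ∧ (X, Z) ∈ (leftFactor α P).graph := by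
  rw [K, mem_pcomp_graph]
  refine exists_congr fun X => and_congr_left' ?_
  rw [mem_pcomp_graph, exists_rightFactor_H0_iff]

/-- Applying a to g = s X - √α a†Ψ gives a s X - √α a a†Ψ. The term of K supplies the first part and
T the second, since α = (√α)²; the sum is X + √α a(v)Ψ. -/
theorem K_add_T_component {α : ℝ} (hα : 0 < α) (P : R3) (Ψ X g : Fock)
    (hg : ∀ n, g n = invSqrt P n (X n)
      - ((√α : ℝ) : ℂ) • raise (annihLevel P) (Ψ : ∀ n, bosons n) n)
    (hS : (ladderBounds P).S g = Ψ) (n : ℕ) :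
    X n + ((√α : ℝ) : ℂ) • annihLevel P n (invSqrt P (n + 1) (X (n + 1)))
        + -((α : ℂ) • annihLevel P n ((annihLevel P n).adjoint (invSqrt P n (g n))))
      = X n + ((√α : ℝ) : ℂ) • annihLevel P n (g (n + 1)) := by
  have hα2 : (α : ℂ) = ((√α : ℝ) : ℂ) * ((√α : ℝ) : ℂ) := by
    rw [← Complex.ofReal_mul, Real.mul_self_sqrt hα.le]
  have h1 : invSqrt P n (g n) = Ψ n := by
    rw [← hS]
    rfl
  rw [h1, hg (n + 1), raise, map_sub, map_smul, hα2]
  exact add_smul_add_neg_mul_smul _ _ _ _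

theorem mem_K_add_T_graph {α : ℝ} (hα : 0 < α) (P : R3) (Ψ η : Fock) :
    (Ψ, η) ∈ (K α P + T α P).graph ↔ ∃ X g : Fock, (ladderBounds P).S g = Ψ ∧ RightEq α P Ψ X ∧
      ∀ n, η n = X n + ((√α : ℝ) : ℂ) • annihLevel P n (g (n + 1)) := by
  rw [mem_add_graph]
  constructor
  · rintro ⟨Z, Y, h1, h2, rfl⟩
    obtain ⟨X, hX, hZ⟩ := (mem_K_graph α P Ψ Z).1 h1
    -- Membership in the domain of K alone already puts Ψ into the form domain.
    obtain ⟨g, rfl, hgn⟩ := (ladderBounds P).exists_S_eq (√α) Ψ X hX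
    refine ⟨X, g, rfl, hX, fun n => ?_⟩
    exact (congrArg₂ (· + ·) ((mem_leftFactor_graph α P X Z).1 hZ n)
      ((mem_T_graph α P g Y).1 h2 n)).trans (K_add_T_component hα P _ X g hgn rfl n)
  · rintro ⟨X, g', hg', hX, hη⟩
    obtain ⟨g, rfl, hgn⟩ := (ladderBounds P).exists_S_eq (√α) Ψ X hX
    obtain rfl : g' = g := (ladderBounds P).S_injective hg'
    obtain ⟨Z, hZ⟩ : ∃ Z : Fock, ∀ n, Z n
        = X n + ((√α : ℝ) : ℂ) • annihLevel P n (invSqrt P (n + 1) (X (n + 1))) :=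
      ⟨X + ((√α : ℝ) : ℂ) • (⟨_, (ladderBounds P).memℓp_a_s X⟩ : Fock), fun n => rfl⟩
    obtain ⟨Y, hY⟩ : ∃ Y : Fock, ∀ n, Y n
        = -((α : ℂ) • annihLevel P n ((annihLevel P n).adjoint (invSqrt P n (g' n)))) :=
      ⟨-((α : ℂ) • (⟨_, (ladderBounds P).memℓp_a_adj_s g'⟩ : Fock)), fun n => rfl⟩
    refine ⟨Z, Y, (mem_K_graph α P _ _).2 ⟨X, hX, (mem_leftFactor_graph α P X Z).2 hZ⟩,
      (mem_T_graph α P g' Y).2 hY, lp.ext (funext fun n => ?_)⟩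
    exact ((congrArg₂ (· + ·) (hZ n) (hY n)).trans
      (K_add_T_component hα P _ X g' hgn rfl n)).trans (hη n).symm

/-! ### The form Q_P and the conclusion -/

theorem mem_formDomain_iff (P : R3) (Ψ : Fock) :
    Ψ ∈ formDomain P ↔ ∃ g, (ladderBounds P).S g = Ψ := by
  simp only [formDomain, LinearPMap.mem_domain_iff, mem_H0sqrt_graph]

theorem interactionTerm_eq (P : R3) (g : Fock) (n : ℕ) :
    interactionTerm ((ladderBounds P).S g) n = inner ℂ (g n) ((ladderBounds P).G g n) := by
  rw [LadderBounds.inner_G_term, Submodule.coe_inner, L2.inner_def, interactionTerm]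
  refine integral_congr_ae ?_
  filter_upwards [annih_ae_eq P ((ladderBounds P).S g) (g (n + 1)) rfl] with k hk
  rw [hk, RCLike.inner_apply, mul_comm]
  rfl

theorem Q_eq (α : ℝ) (P : R3) (Ψ : formDomain P) (g : Fock) (hg : (ladderBounds P).S g = Ψ) :
    Q α P Ψ = (inner ℂ g ((ladderBounds P).L (√α) g)).re := by
  have h1 : H0sqrt P Ψ = g := by
    obtain ⟨hx, h⟩ := (mem_graph_iff_exists _ _ _).1 ((mem_H0sqrt_graph P Ψ g).2 hg)
    exact h
  rw [LadderBounds.re_inner_L, Q, h1, ← hg, lp.inner_eq_tsum]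
  simp only [interactionTerm_eq]

/-- The available bound on a(v)Ψ is only levelwise. The series converges because one factor
H₀^{-1/2} moves across the pairing, giving ⟪g, G g⟫ with `G` bounded. -/
theorem formDomain_wellDefined (P : R3) (Ψ : Fock) (hΨ : Ψ ∈ formDomain P) :
    AnnihConv Ψ ∧ (∀ n : ℕ, MemLp (annih Ψ n) 2 volume) ∧ Summable (interactionTerm Ψ) := by
  obtain ⟨g, rfl⟩ := (mem_formDomain_iff P Ψ).1 hΨ
  refine ⟨annihConv_of_eq P _ (fun n => g (n + 1)) fun n => rfl, fun n => ?_, ?_⟩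
  · exact (memLp_congr_ae (annih_ae_eq P ((ladderBounds P).S g) (g (n + 1)) rfl)).2 (Lp.memLp _)
  · rw [funext (interactionTerm_eq P g)]
    exact lp.summable_inner g _

/-- T and the left factor of K impose no further condition: with g = s X - √α a†Ψ and Ψ = S g, both
a s X and a a† s g are square summable. -/
theorem mem_K_add_T_domain_iff {α : ℝ} (hα : 0 < α) (P : R3) (Ψ : Fock) :
    Ψ ∈ (K α P + T α P).domain ↔ ∃ hΨ : Ψ ∈ (rightFactor α P).domain,
      rightFactor α P ⟨Ψ, hΨ⟩ ∈ (H0 P).domain := by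
  have h1 : (∃ hΨ : Ψ ∈ (rightFactor α P).domain, rightFactor α P ⟨Ψ, hΨ⟩ ∈ (H0 P).domain)
      ↔ ∃ X, RightEq α P Ψ X := by
    simp only [← exists_rightFactor_H0_iff, mem_graph_iff_exists]
    constructor
    · rintro ⟨hΨ, h⟩
      exact ⟨_, _, ⟨hΨ, rfl⟩, h, rfl⟩
    · rintro ⟨_, _, ⟨hΨ, rfl⟩, h, rfl⟩
      exact ⟨hΨ, h⟩
  rw [h1, LinearPMap.mem_domain_iff]
  simp only [mem_K_add_T_graph hα]
  constructor
  · rintro ⟨η, X, g, -, hX, -⟩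
    exact ⟨X, hX⟩
  · rintro ⟨X, hX⟩
    obtain ⟨g, hg, hgn⟩ := (ladderBounds P).exists_S_eq (√α) Ψ X hX
    have hm : Memℓp (fun n => annihLevel P n (g (n + 1))) 2 := by
      have := (lp.memℓp (⟨_, (ladderBounds P).memℓp_a_s X⟩ : Fock)).sub
        ((lp.memℓp (⟨_, (ladderBounds P).memℓp_a_adj_s g⟩ : Fock)).const_smul ((√α : ℝ) : ℂ))
      refine (congrArg (Memℓp · 2) (funext fun n => ?_)).mp this
      have h2 : invSqrt P n (g n) = Ψ n := by rw [← hg]; rfl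
      rw [hgn (n + 1), raise, map_sub, map_smul, ← h2]
      rfl
    exact ⟨X + ((√α : ℝ) : ℂ) • (⟨_, hm⟩ : Fock), X, g, hg, hX, fun n => rfl⟩

theorem isFormOf_Q {α : ℝ} (hα : 0 < α) (P : R3) :
    IsFormOf (formDomain P) (Q α P) (K α P + T α P) := by
  -- The shift left open is read off from `L_coercive`: 16 (√α)⁴ C⁴ with C = `√vconst`.
  refine isFormOf_of_graph (ladderBounds P).S ((ladderBounds P).L √α) (ladderBounds P).S_symm
    (ladderBounds P).S_injective ((ladderBounds P).L_symm √α) _ (1 / 2) (by norm_num)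
    ((ladderBounds P).L_coercive √α) (formDomain P) (mem_formDomain_iff P) (Q α P) (Q_eq α P)
    (K α P + T α P) fun Ψ η => ?_
  rw [mem_K_add_T_graph hα, LadderBounds.L_eq_S_iff]
  rfl

end Froehlich

end

/-- For `α > 0` and `P ∈ ℝ³`: the operators `a(v)H₀⁻¹` and `H₀⁻¹a*(v)` are everywhere defined; the
form `Q_P` is well defined on `D(H₀^{1/2})` (all integrals and sums converge absolutely);
`K(P) + T(P)` has domain `{Ψ | (1 + √α H₀⁻¹a*(v))Ψ ∈ D(H₀)}`; and `K(P) + T(P)` is a self-adjoint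
operator whose form is `Q_P`. -/
theorem propositionA1 (α : ℝ) (hα : 0 < α) (P : Froehlich.R3) :
    (Froehlich.pcomp Froehlich.annihOp (Froehlich.H0inv P)).domain = ⊤ ∧
    (Froehlich.H0invCreat P).domain = ⊤ ∧
    (∀ Ψ ∈ Froehlich.formDomain P,
      Froehlich.AnnihConv Ψ ∧
      (∀ n : ℕ, MeasureTheory.MemLp (Froehlich.annih Ψ n) 2 MeasureTheory.volume) ∧
      Summable (Froehlich.interactionTerm Ψ)) ∧
    (∀ Ψ : Froehlich.Fock, Ψ ∈ (Froehlich.K α P + Froehlich.T α P).domain ↔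
      ∃ hΨ : Ψ ∈ (Froehlich.rightFactor α P).domain,
        Froehlich.rightFactor α P ⟨Ψ, hΨ⟩ ∈ (Froehlich.H0 P).domain) ∧
    Froehlich.IsFormOf (Froehlich.formDomain P) (Froehlich.Q α P)
      (Froehlich.K α P + Froehlich.T α P) := by
  exact ⟨Froehlich.annihOp_H0inv_domain P, Froehlich.H0invCreat_domain P,
    Froehlich.formDomain_wellDefined P, Froehlich.mem_K_add_T_domain_iff hα P,
    Froehlich.isFormOf_Q hα P⟩
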